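/- **Setting.** For $c\ge 0$, $\kappa\in\mathbb{R}$ consider the travelling wave equation $$icu'+u''+u(1-|u|^2)+\kappa u(1-|u|^2)''=0\quad\text{on }\mathbb{R},\qquad(\mathrm{TW})$$ in the energy space $\mathcal{X}(\mathbb{R})=\{v\in H^1_{\mathrm{loc}}(\mathbb{R};\mathbb{C}):1-|v|^2\in L^2(\mathbb{R}),\ v'\in L^2(\mathbb{R})\}$. With $\langle z,w\rangle=\operatorname{Re}(z\bar w)$, a function $u\in\mathcal{X}(\mathbb{R})$ is a (weak) solution if for all $\phi\in C_0^\infty(\mathbb{R};\mathbb{C})$ $$\int_{\mathbb{R}}\langle icu'+u(1-|u|^2),\phi\rangle-\langle u',\phi'\rangle+2\kappa\langle u,u'\rangle\langle u,\phi\rangle'=0 .$$ Let $$\mathcal{D}_1=\{0\le c<\sqrt2,\ 0<\kappa<\tfrac12\},\quad \mathcal{D}_3=\{c>\sqrt2,\ \kappa>\tfrac12\},\quad \mathcal{B}_-=\{c=\sqrt2,\ 0<\kappa<\tfrac12\},\quad \mathcal{B}_+=\{c=\sqrt2,\ \kappa>\tfrac12\},$$ and $\tilde{\mathcal{D}}=\mathcal{D}_1\cup\mathcal{D}_3\cup\mathcal{B}_-\cup\mathcal{B}_+$.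 Put $\mathfrak{T}_\kappa=[1-\frac1{2\kappa},0)$ if $0<\kappa<\frac12$, $\mathfrak{J}_\kappa=(0,1-\frac1{2\kappa}]$ if $\kappa>\frac12$, and $$f_{c,\kappa}(y)=2\sqrt\kappa\arctan\Big(\sqrt\kappa\sqrt{\tfrac{2-c^2-2y}{1-2\kappa+2\kappa y}}\Big)+2\sqrt{\tfrac{1-2\kappa}{2-c^2}}\operatorname{artanh}\Big(\sqrt{\tfrac{(2-c^2)(1-2\kappa+2\kappa y)}{(1-2\kappa)(2-c^2-2y)}}\Big)-\pi\sqrt\kappa$$ for $y\in\mathfrak{T}_\kappa$, $(c,\kappa)\in\mathcal{D}_1$; $h_{c,\kappa}$ is given by the same formula for $y\in\mathfrak{J}_\kappa$, $(c,\kappa)\in\mathcal{D}_3$; $$g_\kappa(y)=2\sqrt\kappa\arctan\Big(\sqrt{\tfrac{-2\kappa y}{1-2\kappa+2\kappa y}}\Big)+\sqrt2\sqrt{-\tfrac{1-2\kappa+2\kappa y}{y}}-\pi\sqrt\kappa$$ for $y\in\mathfrak{T}_\kappa$, $0<\kappa<\frac12$; $\tilde g_\kappa$ is given by the same formula for $y\in\mathfrak{J}_\kappa$,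 $\kappa>\frac12$. At $y=1-\frac1{2\kappa}$, where the denominator $1-2\kappa+2\kappa y$ vanishes, $\arctan$ is read as $\frac\pi2$, so that these functions take the value $0$ there. **Theorem.** Let $(c,\kappa)\in\tilde{\mathcal{D}}$ and let $u\in\mathcal{X}(\mathbb{R})$ be a weak solution of (TW). Then $u$ has a (unique) continuous representative, with which it is identified. Suppose that $u$ is singular, i.e. $u\notin C^2(\mathbb{R})$, and that the critical set $\Gamma=\{x\in\mathbb{R}:|u(x)|^2=\frac1{2\kappa}\}$ is nonempty and bounded, normalised by a translation so that $\sup\Gamma=0$. Let $\mathfrak{a}=\inf\Gamma$ and $\eta=1-|u|^2$. Then: 1. In the corresponding regions, $f_{c,\kappa}$, $g_\kappa$ are bijections from $\mathfrak{T}_\kappa$ onto $[0,\infty)$ and $h_{c,\kappa}$, $\tilde g_\kappa$ are bijections from $\mathfrak{J}_\kappa$ onto $[0,\infty)$, and for all $x\ge0$: $\eta(x)=f_{c,\kappa}^{-1}(x)$ if $(c,\kappa)\in\mathcal{D}_1$, $\eta(x)=h_{c,\kappa}^{-1}(x)$ if $(c,\kappa)\in\mathcal{D}_3$, $\eta(x)=g_\kappa^{-1}(x)$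 if $(c,\kappa)\in\mathcal{B}_-$, $\eta(x)=\tilde g_\kappa^{-1}(x)$ if $(c,\kappa)\in\mathcal{B}_+$. 2. $\eta(x)=\eta(\mathfrak{a}-x)$ for all $x\le\mathfrak{a}$. 3. For all $x\in(-\infty,\mathfrak{a})\cup(0,\infty)$: $1-\frac1{2\kappa}<\eta(x)<0$ if $(c,\kappa)\in\mathcal{D}_1\cup\mathcal{B}_-$, and $0<\eta(x)<1-\frac1{2\kappa}$ if $(c,\kappa)\in\mathcal{D}_3\cup\mathcal{B}_+$. 4. There is a real function $\theta$ such that, on $(-\infty,\mathfrak{a})\cup(0,\infty)$, $u=\sqrt{1-\eta}\,e^{i\theta}$ and $\theta$ is differentiable with $\theta'=\dfrac{c\,\eta}{2-2\eta}$. 5. $u$ is $C^\infty$ on $(-\infty,\mathfrak{a})\cup(0,\infty)$ (and continuous on $\mathbb{R}$). 6. $\eta'(\mathfrak{a}^-)=-\infty$ and $\eta'(0^+)=+\infty$ if $(c,\kappa)\in\mathcal{D}_1\cup\mathcal{B}_-$, while $\eta'(\mathfrak{a}^-)=+\infty$ and $\eta'(0^+)=-\infty$ if $(c,\kappa)\in\mathcal{D}_3\cup\mathcal{B}_+$.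 7. For every integer $j\ge0$ there are constants $C_1,C_2,C_3>0$ such that for all $x\ge1$: $|D^ju'(x)|+|D^j\eta(x)|\le C_1e^{-C_2x}$ if $(c,\kappa)\in\mathcal{D}_1\cup\mathcal{D}_3$, and $|D^ju'(x)|+|D^j\eta(x)|\le C_3x^{-(2+j)}$ if $(c,\kappa)\in\mathcal{B}_+\cup\mathcal{B}_-$. -/

import Mathlib

open Set Filter Topology MeasureTheory
open scoped ContDiff

namespace Cuspon

noncomputable section

/-- `g` is the weak (distributional) derivative of `f` on `ℝ`. -/
def HasWeakDeriv (f g : ℝ → ℂ) : Prop :=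
  LocallyIntegrable f volume ∧ LocallyIntegrable g volume ∧
    ∀ φ : ℝ → ℝ, ContDiff ℝ ∞ φ → HasCompactSupport φ →
      ∫ x, deriv φ x • f x = - ∫ x, φ x • g x

/-- The energy space `{v ∈ H¹_loc(ℝ; ℂ) : 1 - |v|² ∈ L²(ℝ), v' ∈ L²(ℝ)}`, `v'` being the weak
derivative. Membership depends only on the almost-everywhere class of the function. -/
def EnergySpace : Set (ℝ → ℂ) :=
  {v | (∀ K : Set ℝ, IsCompact K → MemLp v 2 (volume.restrict K)) ∧
    (∃ g : ℝ → ℂ, HasWeakDeriv v g ∧ MemLp g 2 volume) ∧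
    MemLp (fun x => 1 - ‖v x‖ ^ 2) 2 volume}

/-- Weak solutions of the travelling wave equation
`i c u' + u'' + u (1 - |u|²) + κ u (1 - |u|²)'' = 0`, tested against `φ ∈ C₀^∞(ℝ; ℂ)` with the real
scalar product `⟨z, w⟩ = Re (z * conj w)` on `ℂ`. Here `g = u'`, and the last bracket is the
derivative of `⟨u, φ⟩`. -/
def IsWeakSolution (c κ : ℝ) (u : ℝ → ℂ) : Prop :=
  ∃ g : ℝ → ℂ, HasWeakDeriv u g ∧
    ∀ φ : ℝ → ℂ, ContDiff ℝ ∞ φ → HasCompactSupport φ →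
      ∫ x, (inner ℝ (Complex.I * (c : ℂ) * g x + u x * ((1 - ‖u x‖ ^ 2 : ℝ) : ℂ)) (φ x)
        - inner ℝ (g x) (deriv φ x)
        + 2 * κ * inner ℝ (u x) (g x) *
            (inner ℝ (g x) (φ x) + inner ℝ (u x) (deriv φ x))) = 0

/-- The intensity profile `η = 1 - |u|²`. -/
def intensity (u : ℝ → ℂ) (x : ℝ) : ℝ := 1 - ‖u x‖ ^ 2

/-- The critical set `Γ(u) = {x : |u(x)|² = 1/(2κ)}`. -/
def criticalSet (κ : ℝ) (u : ℝ → ℂ) : Set ℝ := {x | ‖u x‖ ^ 2 = 1 / (2 * κ)}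

/-! Parameter regions for `(c, κ)`. -/

def D1 : Set (ℝ × ℝ) := {p | 0 ≤ p.1 ∧ p.1 < √2 ∧ 0 < p.2 ∧ p.2 < 1 / 2}

def D3 : Set (ℝ × ℝ) := {p | √2 < p.1 ∧ 1 / 2 < p.2}

def BMinus : Set (ℝ × ℝ) := {p | p.1 = √2 ∧ 0 < p.2 ∧ p.2 < 1 / 2}

def BPlus : Set (ℝ × ℝ) := {p | p.1 = √2 ∧ 1 / 2 < p.2}

def DTilde : Set (ℝ × ℝ) := D1 ∪ D3 ∪ BMinus ∪ BPlus

/-! Domains of the profile functions. -/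

/-- `[1 - 1/(2κ), 0)`, used for `0 < κ < 1/2`. -/
def intervalT (κ : ℝ) : Set ℝ := Ico (1 - 1 / (2 * κ)) 0

/-- `(0, 1 - 1/(2κ)]`, used for `κ > 1/2`. -/
def intervalJ (κ : ℝ) : Set ℝ := Ioc 0 (1 - 1 / (2 * κ))

/-- The function `f_{c,κ}` on `intervalT κ`. At the endpoint `y = 1 - 1/(2κ)` the denominator
`1 - 2κ + 2κy` vanishes, the arctangent there is read as `arctan (+∞) = π/2`, and the value of the
formula is `0`. -/
def profileF (c κ y : ℝ) : ℝ :=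
  if y = 1 - 1 / (2 * κ) then 0
  else
    2 * √κ * Real.arctan (√κ * √((2 - c ^ 2 - 2 * y) / (1 - 2 * κ + 2 * κ * y)))
      + 2 * √((1 - 2 * κ) / (2 - c ^ 2)) *
          Real.artanh (√(((2 - c ^ 2) * (1 - 2 * κ + 2 * κ * y)) /
            ((1 - 2 * κ) * (2 - c ^ 2 - 2 * y))))
      - Real.pi * √κ

/-- The function `h_{c,κ}` on `intervalJ κ`, given by the same formula as `f_{c,κ}`. -/
def profileH (c κ y : ℝ) : ℝ := profileF c κ y

/-- The function `g_κ` on `intervalT κ`, with the same reading at `y = 1 - 1/(2κ)`. -/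
def profileG (κ y : ℝ) : ℝ :=
  if y = 1 - 1 / (2 * κ) then 0
  else
    2 * √κ * Real.arctan (√((-2 * κ * y) / (1 - 2 * κ + 2 * κ * y)))
      + √2 * √(-((1 - 2 * κ + 2 * κ * y) / y))
      - Real.pi * √κ

/-- The function `g̃_κ` on `intervalJ κ`, given by the same formula as `g_κ`. -/
def profileGTilde (κ y : ℝ) : ℝ := profileG κ y

/-- `η` is given on `[0, ∞)` by the inverse of `F : S → [0, ∞)`; that `F` is a bijection of `S`
onto `[0, ∞)` is part of the assertion. -/
def EqInverseOnNonneg (η F : ℝ → ℝ) (S : Set ℝ) : Prop :=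
  BijOn F S (Ici 0) ∧ ∀ x, 0 ≤ x → η x = Function.invFunOn F S x

end

end Cuspon

/-! Write the equation in divergence form: the flux `w = u' - 2κ⟨u,u'⟩u` has weak derivative
`-force`, a locally integrable function. Hence `u` and `w` have continuous representatives. Since
`⟨u,w⟩ = (1 - 2κ|u|²)⟨u,u'⟩`, the derivative `u'` is a continuous function of `(u, w)` off the
critical set, so the equation holds there as a classical first-order system.

This system conserves `⟨iu,w⟩ - (c/2)η` (rotation invariance) and `|u'|² - 2κ⟨u,u'⟩² - η²/2`
(translation invariance). On an interval of infinite length both constants vanish, because `|u'|² +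
η²` is integrable and so takes arbitrarily small values. Eliminating `|u'|²` through `|u|²|u'|² =
⟨u,u'⟩² + ⟨iu,u'⟩²` leaves a scalar equation for `η`. With `η = (2κ-1)ξ` and `c² - 2 = (2κ-1)α²` it
reads `(1 - 2κξ)ξ'² = ξ²(α² + 2ξ)` in all four parameter regions, and `ξ = 1/(2κ)` on the critical
set.

The decisive variable is the slope `r = -ξ'/ξ`, with `r² = (α² + 2ξ)/(1 - 2κξ)`. It is infinite at
the cusp and solves the autonomous polynomial equation `r' = -(r²-α²)(1+κr²)/(2(1+κα²))`.
Integrating by partial fractions, the time at which the slope equals `r` is `travelTime`;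
substituting `r` as a function of `η` turns it into the explicit functions of the statement. The
equilibrium `r = α` is reached only after infinite time, so `ξ` never vanishes and the solution is
defined by this formula on the whole half-line.

Everything else is read off in terms of `r`. Both `η` and `u'/u` are smooth functions of `r` with a
factor `r² - α²`, which gives smoothness, the phase, and the decay: exponential for `α > 0`,
algebraic with `r ≤ 2/x` for `α = 0`. The left half-line reduces to the right one through `x ↦ conj
u(a - x)`. -/

namespace Cuspon

/-! ### Weak derivatives and primitives -/

/-- A smooth compactly supported function of zero mean is the derivative of a smooth compactly
supported function. -/
theorem exists_compactSupport_primitive {ρ : ℝ → ℝ} (hρ : ContDiff ℝ ∞ ρ)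
    (hc : HasCompactSupport ρ) (h0 : ∫ x, ρ x = 0) :
    ∃ φ : ℝ → ℝ, ContDiff ℝ ∞ φ ∧ HasCompactSupport φ ∧ deriv φ = ρ := by
  obtain ⟨R, hRpos, hR⟩ := hc.isCompact.isBounded.subset_closedBall_lt 0 0
  have hz : ∀ x, R < |x| → ρ x = 0 := by
    intro x hx
    by_contra h
    have := hR (subset_tsupport _ h)
    simp at this
    linarith
  have hd : ∀ x, HasDerivAt (fun x => ∫ t in (-R - 1)..x, ρ t) (ρ x) x := fun x =>
    intervalIntegral.integral_hasDerivAt_right (hρ.continuous.intervalIntegrable _ _)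
      hρ.continuous.aestronglyMeasurable.stronglyMeasurableAtFilter hρ.continuous.continuousAt
  have hder : deriv (fun x => ∫ t in (-R - 1)..x, ρ t) = ρ := funext fun x => (hd x).deriv
  -- Starting at `-R - 1` keeps all of `[-R, R]` inside the half-open interval of integration.
  refine ⟨fun x => ∫ t in (-R - 1)..x, ρ t, ?_, ?_, hder⟩
  · exact contDiff_infty_iff_deriv.2 ⟨fun x => (hd x).differentiableAt, by rwa [hder]⟩
  · refine HasCompactSupport.intro (isCompact_Icc (a := -R - 1) (b := R)) fun x hx => ?_
    rcases lt_or_ge x (-R - 1) with h | h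
    · apply intervalIntegral.integral_zero_ae
      refine ae_of_all _ fun t ht => hz t ?_
      rw [uIoc_of_ge h.le] at ht
      rw [abs_of_neg (by linarith [ht.2])]
      linarith [ht.2]
    · have hx' : R < x := by
        by_contra h'
        exact hx ⟨h, not_lt.1 h'⟩
      rw [← h0]
      apply intervalIntegral.integral_eq_integral_of_support_subset
      intro t ht
      have : |t| ≤ R := not_lt.1 fun h => ht (hz t h)
      rw [abs_le] at this
      constructor <;> linarith

/-- Lemma of du Bois-Reymond. -/
theorem ae_eq_const_of_integral_deriv_mul_eq_zero {F : ℝ → ℝ} (hF : LocallyIntegrable F volume)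
    (h : ∀ φ : ℝ → ℝ, ContDiff ℝ ∞ φ → HasCompactSupport φ → ∫ x, deriv φ x * F x = 0) :
    ∃ C : ℝ, ∀ᵐ x, F x = C := by
  let b : ContDiffBump (0 : ℝ) := default
  set χ : ℝ → ℝ := b.normed volume
  have hχ : ContDiff ℝ ∞ χ := b.contDiff_normed
  have hχc : HasCompactSupport χ := b.hasCompactSupport_normed
  have hχ1 : ∫ x, χ x = 1 := b.integral_normed
  refine ⟨∫ x, χ x * F x, ae_eq_of_integral_contDiff_smul_eq hF
    (locallyIntegrable_const _) fun ψ hψ hψc => ?_⟩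
  have hψi : Integrable ψ := hψ.continuous.integrable_of_hasCompactSupport hψc
  have hχi : Integrable χ := hχ.continuous.integrable_of_hasCompactSupport hχc
  -- Subtracting the mean of `ψ` times a bump of mass one leaves a function of zero mean, which is
  -- therefore an admissible `deriv φ`.
  obtain ⟨φ, hφ, hφc, hφd⟩ := exists_compactSupport_primitive
    (ρ := fun x => ψ x - (∫ y, ψ y) * χ x) (hψ.sub (contDiff_const.mul hχ))
    (hψc.sub hχc.mul_left)
    (by rw [integral_sub hψi (hχi.const_mul _), integral_const_mul, hχ1]; ring)
  have := h φ hφ hφc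
  simp only [hφd, sub_mul, mul_assoc] at this
  have i1 : Integrable (fun x => ψ x * F x) :=
    hF.integrable_smul_left_of_hasCompactSupport hψ.continuous hψc
  have i2 : Integrable (fun x => χ x * F x) :=
    hF.integrable_smul_left_of_hasCompactSupport hχ.continuous hχc
  rw [integral_sub i1 (i2.const_mul _), integral_const_mul] at this
  simp only [smul_eq_mul]
  rw [integral_mul_const]
  linarith

/-- The primitive is differentiable only almost everywhere, so the integration by parts is the one
for absolutely continuous functions; the boundary terms vanish because `φ` does. -/
theorem integral_deriv_mul_primitive {A : ℝ → ℝ} (hA : LocallyIntegrable A volume) {φ : ℝ → ℝ}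
    (hφ : ContDiff ℝ ∞ φ) (hc : HasCompactSupport φ) :
    ∫ x, deriv φ x * (∫ t in (0 : ℝ)..x, A t) = - ∫ x, φ x * A x := by
  obtain ⟨R, hRpos, hR⟩ := hc.isCompact.isBounded.subset_closedBall_lt 0 0
  have hz : ∀ x, R < |x| → x ∉ tsupport φ := by
    intro x hx h
    have := hR h
    simp at this
    linarith
  have hsub : ∀ f : ℝ → ℝ, Function.support f ⊆ tsupport φ →
      Function.support f ⊆ Ioc (-R - 1) (R + 1) := by
    intro f hf x hx
    have := not_lt.1 fun h => hz x h (hf hx)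
    rw [abs_le] at this
    constructor <;> linarith
  have hI : IntervalIntegrable A volume (-R - 1) (R + 1) :=
    (hA.integrableOn_isCompact isCompact_uIcc).intervalIntegrable
  have h1 := AbsolutelyContinuousOnInterval.integral_mul_deriv_eq_deriv_mul
    (f := φ) (g := fun x => ∫ t in (0 : ℝ)..x, A t) (a := -R - 1) (b := R + 1)
    (ContDiffOn.absolutelyContinuousOnInterval ((hφ.of_le (by simp)).contDiffOn))
    (hI.absolutelyContinuousOnInterval_intervalIntegral
      (by rw [uIcc_of_le (by linarith)]; constructor <;> linarith))
  have e1 : φ (R + 1) = 0 := image_eq_zero_of_notMem_tsupport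
    (hz _ (by rw [abs_of_pos (by linarith)]; linarith))
  have e2 : φ (-R - 1) = 0 := image_eq_zero_of_notMem_tsupport
    (hz _ (by rw [abs_of_neg (by linarith)]; linarith))
  rw [intervalIntegral.integral_eq_integral_of_support_subset (hsub _ ?_),
    intervalIntegral.integral_eq_integral_of_support_subset (hsub _ ?_), e1, e2] at h1
  · have h2 : ∫ x, φ x * deriv (fun x => ∫ t in (0 : ℝ)..x, A t) x = ∫ x, φ x * A x := by
      apply integral_congr_ae
      filter_upwards [_root_.LocallyIntegrable.ae_hasDerivAt_integral hA] with x hx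
      rw [(hx 0).deriv]
    linarith
  · exact (Function.support_mul_subset_left _ _).trans (support_deriv_subset)
  · exact (Function.support_mul_subset_left _ _).trans (subset_tsupport _)

theorem continuous_primitive_of_locallyIntegrable {E : Type*} [NormedAddCommGroup E]
    [NormedSpace ℝ E] {A : ℝ → E} (hA : LocallyIntegrable A volume) (a : ℝ) :
    Continuous fun x => ∫ t in a..x, A t :=
  intervalIntegral.continuous_primitive
    (fun _ _ => (hA.integrableOn_isCompact isCompact_uIcc).intervalIntegrable) a

/-- A function with a locally integrable weak derivative is a primitive of it. -/
theorem ae_eq_primitive_of_integral_deriv_mul {B A : ℝ → ℝ} (hB : LocallyIntegrable B volume)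
    (hA : LocallyIntegrable A volume)
    (h : ∀ φ : ℝ → ℝ, ContDiff ℝ ∞ φ → HasCompactSupport φ →
      ∫ x, deriv φ x * B x = - ∫ x, φ x * A x) :
    ∃ C : ℝ, ∀ᵐ x, B x = C + ∫ t in (0 : ℝ)..x, A t := by
  have hP := (continuous_primitive_of_locallyIntegrable hA 0).locallyIntegrable (μ := volume)
  obtain ⟨C, hC⟩ := ae_eq_const_of_integral_deriv_mul_eq_zero (hB.sub hP) (by
    intro φ hφ hc
    have hφ' : Continuous (deriv φ) := hφ.continuous_deriv (by simp)
    have i1 := hB.integrable_smul_left_of_hasCompactSupport hφ' hc.deriv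
    have i2 := hP.integrable_smul_left_of_hasCompactSupport hφ' hc.deriv
    simp only [smul_eq_mul] at i1 i2
    simp only [Pi.sub_apply, mul_sub]
    rw [integral_sub i1 i2, h φ hφ hc, integral_deriv_mul_primitive hA hφ hc, sub_self])
  refine ⟨C, hC.mono fun x hx => ?_⟩
  simp only [Pi.sub_apply] at hx
  linarith

theorem locallyIntegrable_re {f : ℝ → ℂ} (hf : LocallyIntegrable f volume) :
    LocallyIntegrable (fun x => (f x).re) volume := fun x =>
  let ⟨s, hs, h⟩ := hf x; ⟨s, hs, Integrable.re h⟩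

theorem locallyIntegrable_im {f : ℝ → ℂ} (hf : LocallyIntegrable f volume) :
    LocallyIntegrable (fun x => (f x).im) volume := fun x =>
  let ⟨s, hs, h⟩ := hf x; ⟨s, hs, Integrable.im h⟩

theorem primitive_re {A : ℝ → ℂ} (hA : LocallyIntegrable A volume) (a b : ℝ) :
    (∫ t in a..b, A t).re = ∫ t in a..b, (A t).re := by
  have := (hA.integrableOn_isCompact (isCompact_uIcc (a := a) (b := b))).intervalIntegrable
  exact (Complex.reCLM.intervalIntegral_comp_comm this).symm

theorem primitive_im {A : ℝ → ℂ} (hA : LocallyIntegrable A volume) (a b : ℝ) :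
    (∫ t in a..b, A t).im = ∫ t in a..b, (A t).im := by
  have := (hA.integrableOn_isCompact (isCompact_uIcc (a := a) (b := b))).intervalIntegrable
  exact (Complex.imCLM.intervalIntegral_comp_comm this).symm

/-- Complex version of `ae_eq_primitive_of_integral_deriv_mul`, tested in each component. -/
theorem ae_eq_primitive_of_components {B A : ℝ → ℂ} (hB : LocallyIntegrable B volume)
    (hA : LocallyIntegrable A volume)
    (hre : ∀ φ : ℝ → ℝ, ContDiff ℝ ∞ φ → HasCompactSupport φ →
      ∫ x, deriv φ x * (B x).re = - ∫ x, φ x * (A x).re)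
    (him : ∀ φ : ℝ → ℝ, ContDiff ℝ ∞ φ → HasCompactSupport φ →
      ∫ x, deriv φ x * (B x).im = - ∫ x, φ x * (A x).im) :
    ∃ C : ℂ, ∀ᵐ x, B x = C + ∫ t in (0 : ℝ)..x, A t := by
  obtain ⟨C, hC⟩ := ae_eq_primitive_of_integral_deriv_mul
    (locallyIntegrable_re hB) (locallyIntegrable_re hA) hre
  obtain ⟨D, hD⟩ := ae_eq_primitive_of_integral_deriv_mul
    (locallyIntegrable_im hB) (locallyIntegrable_im hA) him
  refine ⟨⟨C, D⟩, ?_⟩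
  filter_upwards [hC, hD] with x h1 h2
  apply Complex.ext
  · simp [h1, primitive_re hA]
  · simp [h2, primitive_im hA]

/-- A function with a weak derivative `g` agrees almost everywhere with a primitive of `g`. -/
theorem HasWeakDeriv.ae_eq_primitive {f g : ℝ → ℂ} (h : HasWeakDeriv f g) :
    ∃ C : ℂ, ∀ᵐ x, f x = C + ∫ t in (0 : ℝ)..x, g t := by
  have key : ∀ φ : ℝ → ℝ, ContDiff ℝ ∞ φ → HasCompactSupport φ →
      Integrable (fun x => deriv φ x • f x) ∧ Integrable (fun x => φ x • g x) := fun φ hφ hc =>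
    ⟨h.1.integrable_smul_left_of_hasCompactSupport (hφ.continuous_deriv (by simp)) hc.deriv,
      h.2.1.integrable_smul_left_of_hasCompactSupport hφ.continuous hc⟩
  refine ae_eq_primitive_of_components h.1 h.2.1 (fun φ hφ hc => ?_) (fun φ hφ hc => ?_)
  · have e := congrArg Complex.re (h.2.2 φ hφ hc)
    have e1 := integral_re (key φ hφ hc).1
    have e2 := integral_re (key φ hφ hc).2
    simp only [RCLike.re_to_complex, Complex.real_smul, Complex.re_ofReal_mul, Complex.neg_re]
      at e e1 e2
    rw [e1, e2, e]
  · have e := congrArg Complex.im (h.2.2 φ hφ hc)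
    have e1 := integral_im (key φ hφ hc).1
    have e2 := integral_im (key φ hφ hc).2
    simp only [RCLike.im_to_complex, Complex.real_smul, Complex.im_ofReal_mul, Complex.neg_im]
      at e e1 e2
    rw [e1, e2, e]

/-- Weak derivatives are unique. -/
theorem HasWeakDeriv.unique {f g g' : ℝ → ℂ} (h : HasWeakDeriv f g) (h' : HasWeakDeriv f g') :
    g =ᵐ[volume] g' :=
  ae_eq_of_integral_contDiff_smul_eq h.2.1 h'.2.1 fun φ hφ hc =>
    neg_injective ((h.2.2 φ hφ hc).symm.trans (h'.2.2 φ hφ hc))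

end Cuspon

/-! ### The flux and the divergence form of the equation -/

namespace Cuspon

/-- The real scalar product of `ℂ` in coordinates. -/
noncomputable def dot (z w : ℂ) : ℝ := z.re * w.re + z.im * w.im

theorem inner_eq_dot (z w : ℂ) : inner ℝ z w = dot z w := by
  rw [Complex.inner, Complex.mul_re]
  simp [dot]
  ring

theorem norm_sq_eq_re_im (z : ℂ) : ‖z‖ ^ 2 = z.re ^ 2 + z.im ^ 2 := by
  rw [Complex.sq_norm, Complex.normSq_apply]
  ring

/-- The flux `u' - 2κ⟨u, u'⟩u`, whose weak derivative is `-force`. -/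
noncomputable def flux (κ : ℝ) (v g : ℂ) : ℂ := g - (2 * κ * dot v g : ℝ) * v

/-- The zeroth order part `icu' + u(1 - |u|²) + 2κ⟨u, u'⟩u'` of the weak equation. -/
noncomputable def force (c κ : ℝ) (v g : ℂ) : ℂ :=
  Complex.I * c * g + v * ((1 - ‖v‖ ^ 2 : ℝ) : ℂ) + (2 * κ * dot v g : ℝ) * g

/-- The derivative `u'` in terms of `u` and the flux, off the critical set. -/
noncomputable def velocity (κ : ℝ) (v w : ℂ) : ℂ := w + (2 * κ * dot v w / (1 - 2 * κ * ‖v‖ ^ 2) : ℝ) * v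

/-- The factor `1 - 2κ|v|²` is the degeneracy of the quasilinear equation: where it is nonzero, the
flux determines the derivative. -/
theorem dot_flux (κ : ℝ) (v g : ℂ) : dot v (flux κ v g) = (1 - 2 * κ * ‖v‖ ^ 2) * dot v g := by
  rw [norm_sq_eq_re_im]
  simp [flux, dot]
  ring

theorem velocity_flux {κ : ℝ} {v : ℂ} (g : ℂ) (hv : 1 - 2 * κ * ‖v‖ ^ 2 ≠ 0) :
    velocity κ v (flux κ v g) = g := by
  rw [velocity, dot_flux, show 2 * κ * ((1 - 2 * κ * ‖v‖ ^ 2) * dot v g) / (1 - 2 * κ * ‖v‖ ^ 2)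
    = 2 * κ * dot v g by field_simp, flux]
  ring

theorem force_re (c κ : ℝ) (v g : ℂ) :
    (force c κ v g).re = -c * g.im + v.re * (1 - ‖v‖ ^ 2) + 2 * κ * dot v g * g.re := by
  simp only [force, Complex.add_re, Complex.re_mul_ofReal, Complex.re_ofReal_mul]
  simp

theorem force_im (c κ : ℝ) (v g : ℂ) :
    (force c κ v g).im = c * g.re + v.im * (1 - ‖v‖ ^ 2) + 2 * κ * dot v g * g.im := by
  simp only [force, Complex.add_im, Complex.im_mul_ofReal, Complex.im_ofReal_mul]
  simp

/-- The integrand of the weak equation in divergence form. -/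
theorem weak_integrand_eq (c κ : ℝ) (v g p p' : ℂ) :
    inner ℝ (Complex.I * (c : ℂ) * g + v * ((1 - ‖v‖ ^ 2 : ℝ) : ℂ)) p - inner ℝ g p'
      + 2 * κ * inner ℝ v g * (inner ℝ g p + inner ℝ v p')
      = dot (force c κ v g) p - dot (flux κ v g) p' := by
  simp only [inner_eq_dot]
  have h : ∀ z w p : ℂ, dot (z + w) p = dot z p + dot w p := fun z w p => by simp [dot]; ring
  have h' : ∀ z w p : ℂ, dot (z - w) p = dot z p - dot w p := fun z w p => by simp [dot]; ring
  have h2 : ∀ (r : ℝ) (z p : ℂ), dot (r * z) p = r * dot z p := fun r z p => by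
    simp [dot]; ring
  rw [force, flux, h', h2, h (_ + _), h2, h]
  ring

theorem continuous_dot : Continuous fun p : ℂ × ℂ => dot p.1 p.2 := by
  unfold dot
  fun_prop

section Regularity

variable {v g : ℝ → ℂ}

theorem locallyIntegrable_dot (hv : Continuous v) (hg : LocallyIntegrable g volume) :
    LocallyIntegrable (fun x => dot (v x) (g x)) volume :=
  ((locallyIntegrable_re hg).continuous_mul (Complex.continuous_re.comp hv)).add
    ((locallyIntegrable_im hg).continuous_mul (Complex.continuous_im.comp hv))

theorem locallyIntegrable_ofReal {f : ℝ → ℝ} (hf : LocallyIntegrable f volume) :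
    LocallyIntegrable (fun x => (f x : ℂ)) volume := fun x =>
  let ⟨s, hs, h⟩ := hf x; ⟨s, hs, Integrable.ofReal h⟩

theorem locallyIntegrable_flux (κ : ℝ) (hv : Continuous v) (hg : LocallyIntegrable g volume) :
    LocallyIntegrable (fun x => flux κ (v x) (g x)) volume :=
  hg.sub (LocallyIntegrable.mul_continuous hv (locallyIntegrable_ofReal
    ((locallyIntegrable_dot hv hg).continuous_mul continuous_const)))

/-- The force is quadratic in `g`; the products of components of `g` are integrable because `g` is
square integrable. -/
theorem locallyIntegrable_force (c κ : ℝ) (hv : Continuous v) (hg : MemLp g 2 volume) :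
    LocallyIntegrable (fun x => force c κ (v x) (g x)) volume := by
  have hg1 : LocallyIntegrable g volume := hg.locallyIntegrable (by norm_num)
  have hre : MemLp (fun x => ((g x).re : ℂ)) 2 volume := hg.re.ofReal
  have him : MemLp (fun x => ((g x).im : ℂ)) 2 volume := hg.im.ofReal
  have h1 : LocallyIntegrable (fun x => (((v x).re : ℂ)) * (((g x).re : ℂ) * g x)) volume :=
    (hre.integrable_mul hg).locallyIntegrable.continuous_mul (by fun_prop)
  have h2 : LocallyIntegrable (fun x => (((v x).im : ℂ)) * (((g x).im : ℂ) * g x)) volume :=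
    (him.integrable_mul hg).locallyIntegrable.continuous_mul (by fun_prop)
  have h3 : LocallyIntegrable (fun x => (Complex.I * c) * g x) volume :=
    hg1.continuous_mul continuous_const
  have h4 : LocallyIntegrable (fun x => v x * ((1 - ‖v x‖ ^ 2 : ℝ) : ℂ)) volume :=
    Continuous.locallyIntegrable (by fun_prop)
  have h5 : LocallyIntegrable (fun x => ((2 * κ : ℝ) : ℂ) *
      ((((v x).re : ℂ)) * (((g x).re : ℂ) * g x) + (((v x).im : ℂ)) * (((g x).im : ℂ) * g x)))
      volume := (h1.add h2).continuous_mul continuous_const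
  refine ((h3.add h4).add h5).congr (ae_of_all _ fun x => ?_)
  simp only [force, dot, Pi.add_apply]
  push_cast
  ring

/-- Test functions `φ z` with `φ` real and `z = 1` or `z = I` isolate the two components. -/
theorem integral_flux_component {c κ : ℝ} (hv : Continuous v) (hg : MemLp g 2 volume)
    (hw : ∀ φ : ℝ → ℂ, ContDiff ℝ ∞ φ → HasCompactSupport φ →
      ∫ x, (dot (force c κ (v x) (g x)) (φ x) - dot (flux κ (v x) (g x)) (deriv φ x)) = 0) :
    (∀ φ : ℝ → ℝ, ContDiff ℝ ∞ φ → HasCompactSupport φ →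
      ∫ x, deriv φ x * (flux κ (v x) (g x)).re = - ∫ x, φ x * (-force c κ (v x) (g x)).re) ∧
    (∀ φ : ℝ → ℝ, ContDiff ℝ ∞ φ → HasCompactSupport φ →
      ∫ x, deriv φ x * (flux κ (v x) (g x)).im = - ∫ x, φ x * (-force c κ (v x) (g x)).im) := by
  have hB := locallyIntegrable_flux κ hv (hg.locallyIntegrable (by norm_num))
  have hA := locallyIntegrable_force c κ hv hg
  have key : ∀ (z : ℂ) (φ : ℝ → ℝ), ContDiff ℝ ∞ φ → HasCompactSupport φ →
      ∫ x, (φ x * dot (force c κ (v x) (g x)) z - deriv φ x * dot (flux κ (v x) (g x)) z) = 0 := by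
    intro z φ hφ hc
    have h := hw (fun x => (φ x : ℂ) * z) ((Complex.ofRealCLM.contDiff.comp hφ).mul contDiff_const)
      (HasCompactSupport.mul_right (hc.comp_left Complex.ofReal_zero))
    rw [← h]
    refine integral_congr_ae (ae_of_all _ fun x => ?_)
    have hd : deriv (fun x => (φ x : ℂ) * z) x = ((deriv φ x : ℝ) : ℂ) * z :=
      (((hφ.differentiable (by simp)) x).hasDerivAt.ofReal_comp.mul_const z).deriv
    simp only [hd]
    simp [dot]
    ring
  constructor
  · intro φ hφ hc
    have i1 := (locallyIntegrable_re hA).integrable_smul_left_of_hasCompactSupport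
      hφ.continuous hc
    have i2 := (locallyIntegrable_re hB).integrable_smul_left_of_hasCompactSupport
      (hφ.continuous_deriv (by simp)) hc.deriv
    have h := key 1 φ hφ hc
    simp only [dot, Complex.one_re, Complex.one_im, mul_one, mul_zero, add_zero] at h
    simp only [smul_eq_mul] at i1 i2
    rw [integral_sub i1 i2] at h
    simp only [Complex.neg_re, mul_neg, integral_neg]
    linarith
  · intro φ hφ hc
    have i1 := (locallyIntegrable_im hA).integrable_smul_left_of_hasCompactSupport
      hφ.continuous hc
    have i2 := (locallyIntegrable_im hB).integrable_smul_left_of_hasCompactSupport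
      (hφ.continuous_deriv (by simp)) hc.deriv
    have h := key Complex.I φ hφ hc
    simp only [dot, Complex.I_re, Complex.I_im, mul_one, mul_zero, zero_add] at h
    simp only [smul_eq_mul] at i1 i2
    rw [integral_sub i1 i2] at h
    simp only [Complex.neg_im, mul_neg, integral_neg]
    linarith

/-- A finite energy weak solution has a continuous representative `v`, and its flux has a
continuous representative `w`; both are primitives. -/
theorem exists_primitives {c κ : ℝ} {u : ℝ → ℂ} (hu : u ∈ EnergySpace)
    (hsol : IsWeakSolution c κ u) :
    ∃ v g w : ℝ → ℂ, Continuous v ∧ Continuous w ∧ v =ᵐ[volume] u ∧ MemLp g 2 volume ∧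
      MemLp (fun x => 1 - ‖v x‖ ^ 2) 2 volume ∧
      (∃ C, ∀ x, v x = C + ∫ t in (0 : ℝ)..x, g t) ∧
      LocallyIntegrable (fun x => -force c κ (v x) (g x)) volume ∧
      (∃ C, ∀ x, w x = C + ∫ t in (0 : ℝ)..x, -force c κ (v t) (g t)) ∧
      ∀ᵐ x, flux κ (v x) (g x) = w x := by
  obtain ⟨-, ⟨g, hug, hg⟩, hη⟩ := hu
  obtain ⟨g', hug', hw⟩ := hsol
  obtain ⟨C, hC⟩ := hug.ae_eq_primitive
  have hgg' := hug.unique hug'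
  set v : ℝ → ℂ := fun x => C + ∫ t in (0 : ℝ)..x, g t with hv_def
  have hv : Continuous v := continuous_const.add (continuous_primitive_of_locallyIntegrable hug.2.1 0)
  have hvu : v =ᵐ[volume] u := hC.mono fun x hx => hx.symm
  have hA : LocallyIntegrable (fun x => -force c κ (v x) (g x)) volume :=
    (locallyIntegrable_force c κ hv hg).neg
  have hw' : ∀ φ : ℝ → ℂ, ContDiff ℝ ∞ φ → HasCompactSupport φ →
      ∫ x, (dot (force c κ (v x) (g x)) (φ x) - dot (flux κ (v x) (g x)) (deriv φ x)) = 0 := by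
    intro φ hφ hc
    rw [← hw φ hφ hc]
    apply integral_congr_ae
    filter_upwards [hvu, hgg'] with x h1 h2
    rw [weak_integrand_eq, h1, h2]
  obtain ⟨h1, h2⟩ := integral_flux_component hv hg hw'
  obtain ⟨D, hD⟩ := ae_eq_primitive_of_components
    (locallyIntegrable_flux κ hv (hg.locallyIntegrable (by norm_num))) hA h1 h2
  refine ⟨v, g, fun x => D + ∫ t in (0 : ℝ)..x, -force c κ (v t) (g t), hv,
    continuous_const.add (continuous_primitive_of_locallyIntegrable hA 0), hvu, hg, ?_,
    ⟨C, fun x => rfl⟩, hA, ⟨D, fun x => rfl⟩, hD⟩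
  refine (memLp_congr_ae ?_).1 hη
  filter_upwards [hvu] with x hx
  rw [hx]

end Regularity

/-- A primitive of a function that agrees almost everywhere on an open set with a continuous one
is differentiable there. -/
theorem hasDerivAt_primitive_of_ae_eq {P f F : ℝ → ℂ} {O : Set ℝ} {C : ℂ} (hO : IsOpen O)
    (hf : LocallyIntegrable f volume) (hP : ∀ x, P x = C + ∫ t in (0 : ℝ)..x, f t)
    (hfF : ∀ᵐ x, x ∈ O → f x = F x) (hF : ContinuousOn F O) {x : ℝ} (hx : x ∈ O) :
    HasDerivAt P (F x) x := by
  have hP' : P = fun x => C + ∫ t in (0 : ℝ)..x, f t := funext hP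
  rw [hP']
  refine HasDerivAt.const_add C (intervalIntegral.integral_hasDerivAt_of_tendsto_ae_right
    (hf.integrableOn_isCompact isCompact_uIcc).intervalIntegrable ?_ ?_)
  · obtain ⟨s, hs, h⟩ := hf x
    exact ⟨s, hs, h.aestronglyMeasurable⟩
  · have h1 : Tendsto F (𝓝 x ⊓ ae volume) (𝓝 (F x)) :=
      ((hF.continuousAt (hO.mem_nhds hx)).tendsto).mono_left inf_le_left
    refine h1.congr' ?_
    filter_upwards [mem_inf_of_left (hO.mem_nhds hx), mem_inf_of_right hfF] with y h2 h3
    exact (h3 h2).symm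

end Cuspon

/-! ### First integrals off the critical set -/

namespace Cuspon

theorem _root_.HasDerivAt.complex_re {f : ℝ → ℂ} {f' : ℂ} {x : ℝ} (h : HasDerivAt f f' x) :
    HasDerivAt (fun x => (f x).re) f'.re x :=
  Complex.reCLM.hasFDerivAt.comp_hasDerivAt x h

theorem _root_.HasDerivAt.complex_im {f : ℝ → ℂ} {f' : ℂ} {x : ℝ} (h : HasDerivAt f f' x) :
    HasDerivAt (fun x => (f x).im) f'.im x :=
  Complex.imCLM.hasFDerivAt.comp_hasDerivAt x h

/-- The angular momentum `⟨iz, w⟩`. -/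
noncomputable def cross (z w : ℂ) : ℝ := z.re * w.im - z.im * w.re

theorem hasDerivAt_intensity {v : ℝ → ℂ} {g : ℂ} {x : ℝ} (h : HasDerivAt v g x) :
    HasDerivAt (intensity v) (-2 * dot (v x) g) x := by
  have e : intensity v = fun x => 1 - ((v x).re ^ 2 + (v x).im ^ 2) := by
    funext y
    rw [intensity, norm_sq_eq_re_im]
  rw [e]
  convert! ((h.complex_re.pow 2).add (h.complex_im.pow 2)).const_sub 1 using 1
  simp [dot]
  ring

section FirstIntegrals

variable {c κ : ℝ} {v w : ℝ → ℂ} {x : ℝ}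

theorem velocity_re (κ : ℝ) (v w : ℂ) :
    (velocity κ v w).re = w.re + 2 * κ * (dot v w / (1 - 2 * κ * ‖v‖ ^ 2)) * v.re := by
  simp only [velocity, Complex.add_re, Complex.re_ofReal_mul]
  ring

theorem velocity_im (κ : ℝ) (v w : ℂ) :
    (velocity κ v w).im = w.im + 2 * κ * (dot v w / (1 - 2 * κ * ‖v‖ ^ 2)) * v.im := by
  simp only [velocity, Complex.add_im, Complex.im_ofReal_mul]
  ring

theorem dot_velocity (κ : ℝ) {v w : ℂ} (h : 1 - 2 * κ * ‖v‖ ^ 2 ≠ 0) :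
    dot v (velocity κ v w) = dot v w / (1 - 2 * κ * ‖v‖ ^ 2) := by
  have e := norm_sq_eq_re_im v
  rw [eq_div_iff h]
  rw [e] at h
  rw [dot, velocity_re, velocity_im, e]
  field_simp
  simp only [dot]
  ring

theorem cross_velocity (κ : ℝ) (v w : ℂ) : cross v (velocity κ v w) = cross v w := by
  rw [cross, velocity_re, velocity_im, cross]
  ring

/-- Pair the equation with `iu`. The quasilinear terms cancel, and the derivative of `⟨iu,w⟩` that
remains is `-c⟨u,u'⟩ = (c/2)η'`. -/
theorem hasDerivAt_momentum (hm : 1 - 2 * κ * ‖v x‖ ^ 2 ≠ 0)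
    (hv : HasDerivAt v (velocity κ (v x) (w x)) x)
    (hw : HasDerivAt w (-force c κ (v x) (velocity κ (v x) (w x))) x) :
    HasDerivAt (fun x => cross (v x) (w x) - c / 2 * intensity v x) 0 x := by
  convert! ((hv.complex_re.mul hw.complex_im).sub (hv.complex_im.mul hw.complex_re)).sub
    ((hasDerivAt_intensity hv).const_mul (c / 2)) using 1
  rw [Complex.neg_re, Complex.neg_im, force_re, force_im, dot_velocity κ hm]
  obtain ⟨l, hl⟩ : ∃ l, l = dot (v x) (w x) / (1 - 2 * κ * ‖v x‖ ^ 2) := ⟨_, rfl⟩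
  have hs : l * (1 - 2 * κ * ‖v x‖ ^ 2) = (v x).re * (w x).re + (v x).im * (w x).im := by
    rw [hl, div_mul_cancel₀ _ hm, dot]
  simp only [velocity_re, velocity_im, ← hl]
  rw [norm_sq_eq_re_im] at hs ⊢
  linear_combination -c * hs

/-- Pair the equation with `u'`. The quantity equals `|u'|² - 2κ⟨u,u'⟩² - η²/2`; it is expressed
through `w` because `w`, unlike `u'`, is already known to be differentiable. -/
theorem hasDerivAt_energy (hm : 1 - 2 * κ * ‖v x‖ ^ 2 ≠ 0)
    (hv : HasDerivAt v (velocity κ (v x) (w x)) x)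
    (hw : HasDerivAt w (-force c κ (v x) (velocity κ (v x) (w x))) x) :
    HasDerivAt (fun x => (w x).re ^ 2 + (w x).im ^ 2
      + 2 * κ * (dot (v x) (w x) ^ 2 / (1 - 2 * κ * ‖v x‖ ^ 2)) - intensity v x ^ 2 / 2) 0 x := by
  have hη := hasDerivAt_intensity hv
  have hm' : HasDerivAt (fun x => 1 - 2 * κ * ‖v x‖ ^ 2)
      (2 * κ * (-2 * dot (v x) (velocity κ (v x) (w x)))) x := by
    convert! (hη.const_mul (2 * κ)).const_add (1 - 2 * κ) using 1
    funext y
    simp only [intensity]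
    ring
  obtain ⟨l, hl⟩ : ∃ l, l = dot (v x) (w x) / (1 - 2 * κ * ‖v x‖ ^ 2) := ⟨_, rfl⟩
  have hd : dot (v x) (w x) = l * (1 - 2 * κ * ‖v x‖ ^ 2) := by
    rw [hl, div_mul_cancel₀ _ hm]
  have hdot : dot (v x) (velocity κ (v x) (w x)) = l := by rw [dot_velocity κ hm, hl]
  have hs : HasDerivAt (fun x => dot (v x) (w x)) _ x :=
    (hv.complex_re.mul hw.complex_re).add (hv.complex_im.mul hw.complex_im)
  obtain ⟨s', hs'⟩ : ∃ s', s' = (velocity κ (v x) (w x)).re * (w x).re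
    + (v x).re * (-force c κ (v x) (velocity κ (v x) (w x))).re
    + ((velocity κ (v x) (w x)).im * (w x).im
    + (v x).im * (-force c κ (v x) (velocity κ (v x) (w x))).im) := ⟨_, rfl⟩
  rw [← hs'] at hs
  rw [hdot] at hm' hη
  have hq : HasDerivAt (fun x => dot (v x) (w x) ^ 2 / (1 - 2 * κ * ‖v x‖ ^ 2))
      (2 * l * s' - l ^ 2 * (2 * κ * (-2 * l))) x := by
    convert! (hs.pow 2).div hm' hm using 1
    simp only [hd, Pi.pow_apply, Nat.cast_ofNat, Nat.add_one_sub_one, pow_one]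
    field_simp
  convert! (((hw.complex_re.pow 2).add (hw.complex_im.pow 2)).add (hq.const_mul (2 * κ))).sub
    ((hη.pow 2).div_const 2) using 1
  have hd' : (v x).re * (w x).re + (v x).im * (w x).im
      = l * (1 - 2 * κ * ((v x).re ^ 2 + (v x).im ^ 2)) := by
    rw [← norm_sq_eq_re_im, ← hd, dot]
  rw [hs', Complex.neg_re, Complex.neg_im, force_re, force_im, hdot, velocity_re, velocity_im, ← hl,
    intensity, norm_sq_eq_re_im]
  simp only [Nat.cast_ofNat, Nat.add_one_sub_one, pow_one]
  linear_combination (2 * (1 - ((v x).re ^ 2 + (v x).im ^ 2)) + 8 * l ^ 2 * κ ^ 2) * hd'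

end FirstIntegrals

/-- The first integrals of finite energy solutions on an interval `I` off the critical set. -/
structure IsIntegralCurveOn (c κ : ℝ) (v g : ℝ → ℂ) (I : Set ℝ) : Prop where
  hasDerivAt : ∀ x ∈ I, HasDerivAt v (g x) x
  continuousOn : ContinuousOn g I
  momentum : ∀ x ∈ I, cross (v x) (g x) = c / 2 * intensity v x
  energy : ∀ x ∈ I, 2 * ‖g x‖ ^ 2 = 4 * κ * dot (v x) (g x) ^ 2 + intensity v x ^ 2

/-- A substitute for limits at infinity: no decay of the solution is known yet, but an integrable
density cannot stay above a positive constant on a set of infinite measure. -/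
theorem exists_lt_of_integrableOn {F : ℝ → ℝ} {I : Set ℝ} (hI : MeasurableSet I)
    (hvol : volume I = ⊤) (hF : IntegrableOn F I) {δ : ℝ} (hδ : 0 < δ) : ∃ x ∈ I, F x < δ := by
  by_contra! h
  have : IntegrableOn (fun _ : ℝ => δ) I := by
    refine Integrable.mono hF aestronglyMeasurable_const
      ((ae_restrict_iff' hI).2 (ae_of_all _ fun x hx => ?_))
    rw [Real.norm_of_nonneg hδ.le]
    exact (h x hx).trans (le_abs_self _)
  rw [integrableOn_const_iff] at this
  simp [hvol, hδ.ne'] at this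

theorem eq_zero_of_sq_le_mul {K M : ℝ} (h : ∀ δ, 0 < δ → δ ≤ 1 → K ^ 2 ≤ M * δ) : K = 0 := by
  have h1 : Tendsto (fun δ : ℝ => M * δ) (𝓝[>] 0) (𝓝 (M * 0)) :=
    (continuous_const.mul continuous_id).continuousAt.tendsto.mono_left nhdsWithin_le_nhds
  have h2 : K ^ 2 ≤ M * 0 := by
    refine ge_of_tendsto h1 ?_
    filter_upwards [Ioc_mem_nhdsGT (zero_lt_one' ℝ)] with δ hδ using h δ hδ.1 hδ.2
  rw [mul_zero] at h2
  exact pow_eq_zero_iff (two_ne_zero) |>.1 (le_antisymm h2 (sq_nonneg K))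

theorem norm_sq_mul_norm_sq (z w : ℂ) : ‖z‖ ^ 2 * ‖w‖ ^ 2 = dot z w ^ 2 + cross z w ^ 2 := by
  rw [norm_sq_eq_re_im, norm_sq_eq_re_im, dot, cross]
  ring

theorem ContinuousOn.dot {f g : ℝ → ℂ} {s : Set ℝ} (hf : ContinuousOn f s)
    (hg : ContinuousOn g s) : ContinuousOn (fun x => dot (f x) (g x)) s :=
  continuous_dot.comp_continuousOn (hf.prodMk hg)

/-- Off its critical set, a finite energy weak solution satisfies the equation classically, and on
unbounded intervals the first integrals take their values at infinity. -/
theorem exists_integralCurve {c κ : ℝ} (hκ : 0 < κ) {u : ℝ → ℂ} (hu : u ∈ EnergySpace)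
    (hsol : IsWeakSolution c κ u) :
    ∃ v : ℝ → ℂ, Continuous v ∧ v =ᵐ[volume] u ∧
      ∀ I : Set ℝ, IsOpen I → IsPreconnected I → volume I = ⊤ → Disjoint I (criticalSet κ v) →
        ∃ g : ℝ → ℂ, IsIntegralCurveOn c κ v g I := by
  obtain ⟨v, g, w, hv, hw, hvu, hg, hη, ⟨C, hC⟩, hA, ⟨D, hD⟩, hflux⟩ := exists_primitives hu hsol
  refine ⟨v, hv, hvu, fun I hI hIc hvol hdis => ⟨fun x => velocity κ (v x) (w x), ?_⟩⟩
  have hm : ∀ x ∈ I, 1 - 2 * κ * ‖v x‖ ^ 2 ≠ 0 := by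
    intro x hx h
    refine hdis.ne_of_mem hx (show x ∈ criticalSet κ v from ?_) rfl
    rw [criticalSet, mem_ofPred_eq]
    field_simp
    linarith
  -- On `I` the weak derivative agrees almost everywhere with a continuous function of `(v, w)`, so
  -- both primitives become continuously differentiable there.
  have hgG : ∀ᵐ x, x ∈ I → g x = velocity κ (v x) (w x) := by
    filter_upwards [hflux] with x hx hxI
    rw [← hx, velocity_flux _ (hm x hxI)]
  have hdot : Continuous fun x => dot (v x) (w x) := continuous_dot.comp (hv.prodMk hw)
  have hGc : ContinuousOn (fun x => velocity κ (v x) (w x)) I := by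
    unfold velocity
    refine hw.continuousOn.add (ContinuousOn.mul ?_ hv.continuousOn)
    refine Complex.continuous_ofReal.comp_continuousOn (ContinuousOn.div ?_ ?_ hm)
    · exact (continuous_const.mul hdot).continuousOn
    · fun_prop
  have hAc : ContinuousOn (fun x => -force c κ (v x) (velocity κ (v x) (w x))) I := by
    unfold force
    have h1 := ContinuousOn.dot hv.continuousOn hGc
    refine (ContinuousOn.add (ContinuousOn.add (continuousOn_const.mul hGc) ?_) ?_).neg
    · exact Continuous.continuousOn (by fun_prop)
    · exact (Complex.continuous_ofReal.comp_continuousOn (continuousOn_const.mul h1)).mul hGc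
  have hdv : ∀ x ∈ I, HasDerivAt v (velocity κ (v x) (w x)) x := fun x hx =>
    hasDerivAt_primitive_of_ae_eq hI (hg.locallyIntegrable (by norm_num)) hC hgG hGc hx
  have hdw : ∀ x ∈ I, HasDerivAt w (-force c κ (v x) (velocity κ (v x) (w x))) x := by
    intro x hx
    refine hasDerivAt_primitive_of_ae_eq (F := fun x => -force c κ (v x) (velocity κ (v x) (w x)))
      hI hA hD ?_ hAc hx
    filter_upwards [hgG] with y hy hyI
    rw [hy hyI]
  have hconst : ∀ f : ℝ → ℝ, (∀ x ∈ I, HasDerivAt f 0 x) → ∃ K, ∀ x ∈ I, f x = K := by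
    intro f hf
    obtain ⟨y, hy⟩ : I.Nonempty := nonempty_of_measure_ne_zero (by rw [hvol]; simp)
    exact ⟨f y, fun x hx => hI.is_const_of_deriv_eq_zero hIc
      (fun z hz => (hf z hz).differentiableAt.differentiableWithinAt)
      (fun z hz => (hf z hz).deriv) hx hy⟩
  obtain ⟨K, hK⟩ := hconst _ fun x hx => hasDerivAt_momentum (hm x hx) (hdv x hx) (hdw x hx)
  obtain ⟨E, hE⟩ := hconst _ fun x hx => hasDerivAt_energy (hm x hx) (hdv x hx) (hdw x hx)
  have hint : IntegrableOn (fun x => ‖velocity κ (v x) (w x)‖ ^ 2 + intensity v x ^ 2) I := by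
    have h1 : IntegrableOn (fun x => ‖g x‖ ^ 2 + intensity v x ^ 2) I :=
      (((hg.integrable_norm_pow (by norm_num)).add hη.integrable_sq)).integrableOn
    refine h1.congr ?_
    filter_upwards [(ae_restrict_iff' hI.measurableSet).2 hgG] with x hx
    rw [hx]
  have hKx : ∀ x ∈ I, K = cross (v x) (velocity κ (v x) (w x)) - c / 2 * intensity v x := by
    intro x hx
    rw [cross_velocity, hK x hx]
  have hEx : ∀ x ∈ I, E = ‖velocity κ (v x) (w x)‖ ^ 2
      - 2 * κ * dot (v x) (velocity κ (v x) (w x)) ^ 2 - intensity v x ^ 2 / 2 := by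
    intro x hx
    rw [← hE x hx, dot_velocity κ (hm x hx), norm_sq_eq_re_im (velocity _ _ _), velocity_re, velocity_im]
    have hm' := hm x hx
    obtain ⟨l, hl⟩ : ∃ l, l = dot (v x) (w x) / (1 - 2 * κ * ‖v x‖ ^ 2) := ⟨_, rfl⟩
    have hd : dot (v x) (w x) = l * (1 - 2 * κ * ‖v x‖ ^ 2) := by
      rw [hl, div_mul_cancel₀ _ hm']
    have hd' : (v x).re * (w x).re + (v x).im * (w x).im
        = l * (1 - 2 * κ * ((v x).re ^ 2 + (v x).im ^ 2)) := by
      rw [← norm_sq_eq_re_im, ← hd, dot]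
    have hsq : dot (v x) (w x) ^ 2 / (1 - 2 * κ * ‖v x‖ ^ 2)
        = l ^ 2 * (1 - 2 * κ * ((v x).re ^ 2 + (v x).im ^ 2)) := by
      rw [hd, ← norm_sq_eq_re_im]
      field_simp
    rw [hsq, ← hl]
    linear_combination -4 * κ * l * hd'
  have hsmall : ∀ δ, 0 < δ → δ ≤ 1 → ∃ x ∈ I, ‖velocity κ (v x) (w x)‖ ^ 2 ≤ δ ∧
      intensity v x ^ 2 ≤ δ ∧ ‖v x‖ ^ 2 ≤ 2 := by
    intro δ hδ hδ1
    obtain ⟨x, hx, h⟩ := exists_lt_of_integrableOn hI.measurableSet hvol hint hδ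
    have h1 := sq_nonneg ‖velocity κ (v x) (w x)‖
    have h2 := sq_nonneg (intensity v x)
    refine ⟨x, hx, by linarith, by linarith, ?_⟩
    have : -1 ≤ intensity v x := by nlinarith
    rw [intensity] at this
    linarith
  have hcs : ∀ (x δ : ℝ), ‖velocity κ (v x) (w x)‖ ^ 2 ≤ δ → ‖v x‖ ^ 2 ≤ 2 →
      ‖v x‖ ^ 2 * ‖velocity κ (v x) (w x)‖ ^ 2 ≤ 2 * δ := fun x δ h1 h3 =>
    mul_le_mul h3 h1 (sq_nonneg _) (by norm_num)
  have hK0 : K = 0 := by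
    -- With `X = ⟨iv,v'⟩`: `K² ≤ 2X² + c²η²/2`, where `X² ≤ |v|²|v'|² ≤ 2δ` and `η² ≤ δ`.
    refine eq_zero_of_sq_le_mul (M := 4 + c ^ 2 / 2) fun δ hδ hδ1 => ?_
    obtain ⟨x, hx, h1, h2, h3⟩ := hsmall δ hδ hδ1
    have h4 := norm_sq_mul_norm_sq (v x) (velocity κ (v x) (w x))
    have h5 := hcs x δ h1 h3
    have h6 := sq_nonneg (dot (v x) (velocity κ (v x) (w x)))
    rw [hKx x hx]
    have h7 := sq_nonneg (cross (v x) (velocity κ (v x) (w x)) + c / 2 * intensity v x)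
    have h8 := mul_le_mul_of_nonneg_left h2 (sq_nonneg c)
    nlinarith
  have hE0 : E = 0 := by
    -- The three terms of `E` are at most `δ`, `4κδ` and `δ/2`, so `|E| ≤ (4κ+2)δ`; then `δ² ≤ δ`
    -- because `δ ≤ 1`.
    refine eq_zero_of_sq_le_mul (M := (4 * κ + 2) ^ 2) fun δ hδ hδ1 => ?_
    obtain ⟨x, hx, h1, h2, h3⟩ := hsmall δ hδ hδ1
    have h4 := norm_sq_mul_norm_sq (v x) (velocity κ (v x) (w x))
    have h5 := hcs x δ h1 h3
    have h6 := sq_nonneg (cross (v x) (velocity κ (v x) (w x)))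
    have h7 : 2 * κ * dot (v x) (velocity κ (v x) (w x)) ^ 2 ≤ 2 * κ * (2 * δ) :=
      mul_le_mul_of_nonneg_left (by linarith) (by linarith)
    have h7' : 0 ≤ 2 * κ * dot (v x) (velocity κ (v x) (w x)) ^ 2 := by positivity
    have h8 := sq_nonneg ‖velocity κ (v x) (w x)‖
    have h9 := sq_nonneg (intensity v x)
    have hab : |E| ≤ (4 * κ + 2) * δ := by
      rw [hEx x hx, abs_le]
      constructor <;> nlinarith
    calc E ^ 2 = |E| ^ 2 := (sq_abs E).symm
      _ ≤ ((4 * κ + 2) * δ) ^ 2 := by gcongr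
      _ = (4 * κ + 2) ^ 2 * (δ * δ) := by ring
      _ ≤ (4 * κ + 2) ^ 2 * (δ * 1) := by gcongr
      _ = _ := by ring
  refine ⟨hdv, hGc, fun x hx => ?_, fun x hx => ?_⟩
  · linarith [hKx x hx]
  · linarith [hEx x hx]

end Cuspon

/-! ### Travel time and the normalised profile equation -/

namespace Cuspon

/-- The time at which the slope `r = -η'/η` of a cuspon takes the value `r`. -/
noncomputable def travelTime (κ α r : ℝ) : ℝ :=
  2 * √κ * Real.arctan (√κ * r) + (if α = 0 then 2 / r else 2 / α * Real.artanh (α / r))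
    - Real.pi * √κ

theorem artanh_div_eq {α r : ℝ} (hα : 0 ≤ α) (hr : α < r) :
    Real.artanh (α / r) = 1 / 2 * (Real.log (r + α) - Real.log (r - α)) := by
  have h0 : 0 < r := hα.trans_lt hr
  rw [Real.artanh_eq_half_log ⟨by linarith [div_nonneg hα h0.le], ((div_lt_one h0).2 hr).le⟩,
    ← Real.log_div (by linarith) (by linarith)]
  congr 2
  have : r - α ≠ 0 := by linarith
  have : 1 - α / r ≠ 0 := by
    rw [one_sub_div h0.ne']
    positivity
  field_simp

/-- The derivative is the reciprocal of the velocity of the slope, split into partial fractions as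
`2κ/(1+κr²) - 2/(r²-α²)`. The two branches of the definition are primitives of the second term for
`α = 0` and `α > 0`. -/
theorem hasDerivAt_travelTime {κ α r : ℝ} (hκ : 0 < κ) (hα : 0 ≤ α) (hr : α < r) :
    HasDerivAt (travelTime κ α) (-(2 * (1 + κ * α ^ 2) / ((1 + κ * r ^ 2) * (r ^ 2 - α ^ 2)))) r := by
  have h0 : 0 < r := hα.trans_lt hr
  have h1 : 0 < r ^ 2 - α ^ 2 := by nlinarith
  have h2 : 0 < 1 + κ * r ^ 2 := by positivity
  have hsq : √κ ^ 2 = κ := Real.sq_sqrt hκ.le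
  have harc : HasDerivAt (fun r => 2 * √κ * Real.arctan (√κ * r))
      (2 * κ / (1 + κ * r ^ 2)) r := by
    convert! (((hasDerivAt_id r).const_mul (√κ)).arctan).const_mul (2 * √κ) using 1
    simp only [id, mul_pow, hsq]
    field_simp
    rw [hsq]
  have hrest : HasDerivAt (fun r => if α = 0 then 2 / r else 2 / α * Real.artanh (α / r))
      (-(2 / (r ^ 2 - α ^ 2))) r := by
    split_ifs with h
    · subst h
      convert! (hasDerivAt_inv h0.ne').const_mul 2 using 1
      field_simp
      ring
    · have e : (fun r => 2 / α * Real.artanh (α / r)) =ᶠ[𝓝 r]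
          fun r => 2 / α * (1 / 2 * (Real.log (r + α) - Real.log (r - α))) := by
        filter_upwards [Ioi_mem_nhds hr] with s hs
        rw [artanh_div_eq hα hs]
      refine HasDerivAt.congr_of_eventuallyEq ?_ e
      convert! ((((hasDerivAt_id r).add_const α).log (by simp; linarith)).sub
        (((hasDerivAt_id r).sub_const α).log (by simp; linarith))).const_mul (2 / α * (1 / 2)) using 1
      · funext s
        simp
        ring
      · have a1 : r + α ≠ 0 := by linarith
        have a2 : r - α ≠ 0 := by linarith
        have a3 : r ^ 2 - α ^ 2 = (r + α) * (r - α) := by ring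
        simp only [id, a3]
        field_simp
        ring
  convert! (harc.add hrest).sub_const (Real.pi * √κ) using 1
  field_simp
  ring

theorem strictAntiOn_travelTime {κ α : ℝ} (hκ : 0 < κ) (hα : 0 ≤ α) :
    StrictAntiOn (travelTime κ α) (Ioi α) := by
  refine strictAntiOn_of_deriv_neg (convex_Ioi α) (fun r hr =>
    (hasDerivAt_travelTime hκ hα hr).continuousAt.continuousWithinAt) fun r hr => ?_
  rw [interior_Ioi] at hr
  rw [(hasDerivAt_travelTime hκ hα hr).deriv]
  have : 0 < r ^ 2 - α ^ 2 := by nlinarith [mem_Ioi.1 hr]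
  rw [neg_lt_zero]
  positivity

/-- The arctangent term tends to `π√κ`, which the constant in `travelTime` removes: infinite slope,
that is the cusp, sits at time zero. -/
theorem tendsto_travelTime_atTop {κ α : ℝ} (hκ : 0 < κ) (hα : 0 ≤ α) :
    Tendsto (travelTime κ α) atTop (𝓝 0) := by
  have h1 : Tendsto (fun r => 2 * √κ * Real.arctan (√κ * r)) atTop (𝓝 (2 * √κ * (Real.pi / 2))) :=
    ((Real.tendsto_arctan_atTop.mono_right nhdsWithin_le_nhds).comp
      (tendsto_id.const_mul_atTop (Real.sqrt_pos.2 hκ))).const_mul _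
  have h2 : Tendsto (fun r => if α = 0 then 2 / r else 2 / α * Real.artanh (α / r)) atTop (𝓝 0) := by
    split_ifs with h
    · exact tendsto_const_nhds.div_atTop tendsto_id
    · have h3 : Tendsto (fun r : ℝ => 1 + 2 * α / (r - α)) atTop (𝓝 (1 + 0)) :=
        tendsto_const_nhds.add
          (tendsto_const_nhds.div_atTop (tendsto_atTop_add_const_right _ (-α) tendsto_id))
      have h4 := ((Real.continuousAt_log (by norm_num : (1 + 0 : ℝ) ≠ 0)).tendsto.comp h3).const_mul
        (2 / α * (1 / 2))
      rw [add_zero, Real.log_one, mul_zero] at h4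
      refine h4.congr' ?_
      filter_upwards [eventually_gt_atTop α] with r hr
      have : r - α ≠ 0 := by linarith
      rw [artanh_div_eq hα hr, ← Real.log_div (by linarith) this, Function.comp,
        show 1 + 2 * α / (r - α) = (r + α) / (r - α) by field_simp; ring]
      ring
  have h5 := (h1.add h2).sub_const (Real.pi * √κ)
  rwa [show 2 * √κ * (Real.pi / 2) + 0 - Real.pi * √κ = 0 by ring] at h5

/-- The equilibrium slope `α` is not reached in finite time. The divergence is logarithmic for `α >
0` and like `2/r` for `α = 0`. -/
theorem tendsto_travelTime_nhdsGT {κ α : ℝ} (hα : 0 ≤ α) :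
    Tendsto (travelTime κ α) (𝓝[>] α) atTop := by
  have h2 : Tendsto (fun r => if α = 0 then 2 / r else 2 / α * Real.artanh (α / r))
      (𝓝[>] α) atTop := by
    split_ifs with h
    · subst h
      exact tendsto_inv_nhdsGT_zero.const_mul_atTop two_pos
    · have hpos : 0 < α := lt_of_le_of_ne hα (Ne.symm h)
      have h3 : Tendsto (fun r : ℝ => r - α) (𝓝[>] α) (𝓝[>] 0) := by
        refine tendsto_nhdsWithin_iff.2 ⟨?_, ?_⟩
        · have : ContinuousAt (fun r : ℝ => r - α) α := by fun_prop
          simpa using this.tendsto.mono_left nhdsWithin_le_nhds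
        · filter_upwards [self_mem_nhdsWithin] with r hr
          exact sub_pos.2 (mem_Ioi.1 hr)
      have h4 : Tendsto (fun r : ℝ => -Real.log (r - α)) (𝓝[>] α) atTop :=
        tendsto_neg_atBot_atTop.comp (Real.tendsto_log_nhdsGT_zero.comp h3)
      have h5 : Tendsto (fun r : ℝ => Real.log (r + α)) (𝓝[>] α) (𝓝 (Real.log (α + α))) := by
        have : ContinuousAt (fun r : ℝ => Real.log (r + α)) α :=
          ContinuousAt.log (by fun_prop) (by positivity)
        exact this.tendsto.mono_left nhdsWithin_le_nhds
      have h6 := (h5.add_atTop h4).const_mul_atTop (show 0 < 2 / α * (1 / 2) by positivity)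
      refine h6.congr' ?_
      filter_upwards [self_mem_nhdsWithin] with r hr
      rw [artanh_div_eq hα hr]
      ring
  have h1 : Tendsto (fun r => 2 * √κ * Real.arctan (√κ * r)) (𝓝[>] α)
      (𝓝 (2 * √κ * Real.arctan (√κ * α))) := by
    have : Continuous (fun r => 2 * √κ * Real.arctan (√κ * r)) :=
      continuous_const.mul (Real.continuous_arctan.comp (continuous_const.mul continuous_id))
    exact (this.tendsto α).mono_left nhdsWithin_le_nhds
  exact tendsto_atTop_add_const_right _ _ (h1.add_atTop h2)

theorem travelTime_pos {κ α r : ℝ} (hκ : 0 < κ) (hα : 0 ≤ α) (hr : α < r) :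
    0 < travelTime κ α r := by
  have h := strictAntiOn_travelTime hκ hα
  have h1 : travelTime κ α (r + 1) < travelTime κ α r :=
    h hr (show α < r + 1 by linarith) (by linarith)
  refine lt_of_le_of_lt (le_of_tendsto (tendsto_travelTime_atTop hκ hα) ?_) h1
  filter_upwards [eventually_gt_atTop (r + 1)] with s hs
  exact (h (show α < r + 1 by linarith) (show α < s by linarith) hs).le

/-- The slope `r = -ξ'/ξ` of a normalised profile as a function of `ξ`. -/
noncomputable def slope (κ α ξ : ℝ) : ℝ := √((α ^ 2 + 2 * ξ) / (1 - 2 * κ * ξ))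

section Slope

variable {κ α ξ : ℝ}

theorem slope_sq (h0 : 0 ≤ ξ) (h1 : 0 < 1 - 2 * κ * ξ) :
    slope κ α ξ ^ 2 = (α ^ 2 + 2 * ξ) / (1 - 2 * κ * ξ) :=
  Real.sq_sqrt (by positivity)

theorem lt_slope (hκ : 0 < κ) (hα : 0 ≤ α) (h0 : 0 < ξ) (h1 : 0 < 1 - 2 * κ * ξ) :
    α < slope κ α ξ := by
  rw [slope, Real.lt_sqrt hα, lt_div_iff₀ h1]
  have : 0 < κ * ξ * α ^ 2 + ξ := by positivity
  nlinarith

/-- Solving `r²(1 - 2κξ) = α² + 2ξ` makes `ξ` a rational function of `r²`, which turns the profile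
equation into an autonomous one for `r`. -/
theorem one_sub_eq_slope (hκ : 0 < κ) (h0 : 0 ≤ ξ) (h1 : 0 < 1 - 2 * κ * ξ) :
    1 - 2 * κ * ξ = (1 + κ * α ^ 2) / (1 + κ * slope κ α ξ ^ 2) := by
  have : 0 < 1 + κ * slope κ α ξ ^ 2 := by positivity
  rw [eq_div_iff this.ne', slope_sq h0 h1]
  field_simp
  ring

theorem eq_slope (hκ : 0 < κ) (h0 : 0 ≤ ξ) (h1 : 0 < 1 - 2 * κ * ξ) :
    ξ = (slope κ α ξ ^ 2 - α ^ 2) / (2 * (1 + κ * slope κ α ξ ^ 2)) := by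
  have h2 : 0 < 1 + κ * slope κ α ξ ^ 2 := by positivity
  have h3 := one_sub_eq_slope (α := α) hκ h0 h1
  rw [eq_div_iff h2.ne'] at h3
  rw [eq_div_iff (by positivity)]
  have : κ * (ξ * (2 * (1 + κ * slope κ α ξ ^ 2))) = κ * (slope κ α ξ ^ 2 - α ^ 2) := by linarith
  exact mul_left_cancel₀ hκ.ne' this

end Slope

/-- The normalised profile equation `(1 - 2κξ) ξ'² = ξ² (α² + 2ξ)` on `(0, ∞)`, started from the
singular value `ξ = 1/(2κ)`. -/
structure IsNormalProfile (κ α : ℝ) (ξ ξ' : ℝ → ℝ) : Prop where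
  continuousOn : ContinuousOn ξ (Ici 0)
  init : 2 * κ * ξ 0 = 1
  ne : ∀ x, 0 < x → 2 * κ * ξ x ≠ 1
  hasDerivAt : ∀ x, 0 < x → HasDerivAt ξ (ξ' x) x
  continuousOn_deriv : ContinuousOn ξ' (Ioi 0)
  eqn : ∀ x, 0 < x → (1 - 2 * κ * ξ x) * ξ' x ^ 2 = ξ x ^ 2 * (α ^ 2 + 2 * ξ x)

namespace IsNormalProfile

variable {κ α : ℝ} {ξ ξ' : ℝ → ℝ}

/-- If `1 - 2κξ` were negative, `ξ` would be positive, and the two sides of the equation would have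
opposite signs. -/
theorem one_sub_pos (h : IsNormalProfile κ α ξ ξ') (hκ : 0 < κ) {x : ℝ} (hx : 0 < x) :
    0 < 1 - 2 * κ * ξ x := by
  by_contra hneg
  have hgt : 1 - 2 * κ * ξ x < 0 := lt_of_le_of_ne (not_lt.1 hneg) fun e => h.ne x hx (by linarith)
  have hpos : 0 < ξ x := by
    by_contra h'
    have := mul_nonneg hκ.le (neg_nonneg.2 (not_lt.1 h'))
    linarith
  have h1 := h.eqn x hx
  have h2 : 0 < ξ x ^ 2 * (α ^ 2 + 2 * ξ x) := by positivity
  have h3 := mul_nonneg (neg_nonneg.2 hgt.le) (sq_nonneg (ξ' x))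
  linarith

theorem init_pos (h : IsNormalProfile κ α ξ ξ') (hκ : 0 < κ) : 0 < ξ 0 := by
  by_contra h'
  have := mul_nonneg hκ.le (neg_nonneg.2 (not_lt.1 h'))
  linarith [h.init]

/-- The equation fixes `ξ'` up to sign. While `ξ > 0`, `ξ'` has no zero, hence a constant sign; a
positive one would lift `ξ` above its initial value `1/(2κ)`, against `one_sub_pos`. -/
theorem deriv_eq_of_pos (h : IsNormalProfile κ α ξ ξ') (hκ : 0 < κ) {b : ℝ}
    (hpos : ∀ x ∈ Ioo 0 b, 0 < ξ x) :
    ∀ x ∈ Ioo 0 b, ξ' x = -(slope κ α (ξ x) * ξ x) := by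
  have hne : ∀ x ∈ Ioo 0 b, ξ' x ≠ 0 := by
    intro x hx h0
    have h1 := h.eqn x hx.1
    have h2 := hpos x hx
    have h3 : 0 < ξ x ^ 2 * (α ^ 2 + 2 * ξ x) := by positivity
    rw [h0] at h1
    linarith
  have hneg : ∀ x ∈ Ioo 0 b, ξ' x < 0 := by
    intro x hx
    by_contra hx'
    have hx1 : 0 < ξ' x := lt_of_le_of_ne (not_lt.1 hx') (hne x hx).symm
    have hall : ∀ y ∈ Ioo 0 b, 0 < ξ' y := by
      intro y hy
      by_contra hy'
      obtain ⟨z, hz, hz0⟩ := isPreconnected_Ioo.intermediate_value hy hx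
        (h.continuousOn_deriv.mono Ioo_subset_Ioi_self) ⟨not_lt.1 hy', hx1.le⟩
      exact hne z hz hz0
    have hmono : StrictMonoOn ξ (Icc 0 x) := by
      refine strictMonoOn_of_deriv_pos (convex_Icc 0 x)
        (h.continuousOn.mono Icc_subset_Ici_self) fun y hy => ?_
      rw [interior_Icc] at hy
      rw [(h.hasDerivAt y hy.1).deriv]
      exact hall y ⟨hy.1, hy.2.trans hx.2⟩
    have h1 := hmono (left_mem_Icc.2 hx.1.le) (right_mem_Icc.2 hx.1.le) hx.1
    have h2 := h.one_sub_pos hκ hx.1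
    have h3 := h.init
    have := mul_lt_mul_of_pos_left h1 hκ
    linarith
  intro x hx
  have h1 := h.one_sub_pos hκ hx.1
  have h2 := hpos x hx
  have h3 : ξ' x ^ 2 = (slope κ α (ξ x) * ξ x) ^ 2 := by
    rw [mul_pow, slope, Real.sq_sqrt (by positivity), div_mul_eq_mul_div, eq_div_iff h1.ne']
    linarith [h.eqn x hx.1]
  rcases sq_eq_sq_iff_eq_or_eq_neg.1 h3 with h4 | h4
  · have h5 : 0 ≤ slope κ α (ξ x) * ξ x := mul_nonneg (Real.sqrt_nonneg _) h2.le
    linarith [hneg x hx]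
  · exact h4

theorem hasDerivAt_slope_of_pos (h : IsNormalProfile κ α ξ ξ') (hκ : 0 < κ) (hα : 0 ≤ α) {b : ℝ}
    (hpos : ∀ x ∈ Ioo 0 b, 0 < ξ x) {x : ℝ} (hx : x ∈ Ioo 0 b) :
    HasDerivAt (fun x => slope κ α (ξ x)) (-((slope κ α (ξ x) ^ 2 - α ^ 2) *
      ((1 + κ * slope κ α (ξ x) ^ 2) / (2 * (1 + κ * α ^ 2))))) x := by
  have h1 := h.one_sub_pos hκ hx.1
  have h2 := hpos x hx
  have hd := h.hasDerivAt x hx.1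
  rw [h.deriv_eq_of_pos hκ hpos x hx] at hd
  have hr := hα.trans_lt (lt_slope hκ hα h2 h1)
  have hQ := ((hd.const_mul 2).const_add (α ^ 2)).div ((hd.const_mul (2 * κ)).const_sub 1) h1.ne'
  convert! hQ.sqrt (div_pos (by positivity) h1).ne' using 1
  have e1 := one_sub_eq_slope (α := α) hκ h2.le h1
  have e2 := eq_slope (α := α) hκ h2.le h1
  change _ = _ / (2 * slope κ α (ξ x))
  have e3 := slope_sq (α := α) h2.le h1
  obtain ⟨r, hrr⟩ : ∃ r, r = slope κ α (ξ x) := ⟨_, rfl⟩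
  simp only [← hrr] at *
  have e4 : α ^ 2 + 2 * ξ x = r ^ 2 * (1 - 2 * κ * ξ x) := by
    rw [e3, div_mul_cancel₀ _ h1.ne']
  have h5 : 0 < 1 + κ * r ^ 2 := by positivity
  have h6 : 0 < 1 + κ * α ^ 2 := by positivity
  simp only [e4, e1]
  rw [e2]
  field_simp
  ring

theorem tendsto_slope (h : IsNormalProfile κ α ξ ξ') (hκ : 0 < κ) :
    Tendsto (fun x => slope κ α (ξ x)) (𝓝[>] 0) atTop := by
  have hc : Tendsto ξ (𝓝[>] 0) (𝓝 (ξ 0)) :=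
    (h.continuousOn 0 self_mem_Ici).tendsto.mono_left (nhdsWithin_mono _ Ioi_subset_Ici_self)
  have h1 : Tendsto (fun x => α ^ 2 + 2 * ξ x) (𝓝[>] 0) (𝓝 (α ^ 2 + 2 * ξ 0)) :=
    (hc.const_mul 2).const_add _
  have h2 : Tendsto (fun x => 1 - 2 * κ * ξ x) (𝓝[>] 0) (𝓝[>] 0) := by
    refine tendsto_nhdsWithin_iff.2 ⟨?_, ?_⟩
    · have := (hc.const_mul (2 * κ)).const_sub 1
      rwa [h.init, sub_self] at this
    · filter_upwards [self_mem_nhdsWithin] with x hx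
      exact h.one_sub_pos hκ hx
  have h3 := h1.pos_mul_atTop (by have := h.init_pos hκ; positivity) (tendsto_inv_nhdsGT_zero.comp h2)
  exact Real.tendsto_sqrt_atTop.comp h3

/-- The derivative of travel time minus position vanishes, and the difference tends to `0` at the
cusp, where the slope is infinite. -/
theorem travelTime_slope_of_pos (h : IsNormalProfile κ α ξ ξ') (hκ : 0 < κ) (hα : 0 ≤ α) {b : ℝ}
    (hpos : ∀ x ∈ Ioo 0 b, 0 < ξ x) {x : ℝ} (hx : x ∈ Ioo 0 b) :
    travelTime κ α (slope κ α (ξ x)) = x := by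
  have hd : ∀ y ∈ Ioo 0 b,
      HasDerivAt (fun y => travelTime κ α (slope κ α (ξ y)) - y) 0 y := by
    intro y hy
    have h1 := h.one_sub_pos hκ hy.1
    have h2 := hpos y hy
    have hr := lt_slope hκ hα h2 h1
    have h3 : 0 < slope κ α (ξ y) ^ 2 - α ^ 2 := by nlinarith
    have h5 : 0 < 1 + κ * slope κ α (ξ y) ^ 2 := by positivity
    have h6 : 0 < 1 + κ * α ^ 2 := by positivity
    convert! ((hasDerivAt_travelTime hκ hα hr).comp y
      (h.hasDerivAt_slope_of_pos hκ hα hpos hy)).sub (hasDerivAt_id y) using 1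
    field_simp
    ring
  have hconst : ∀ y ∈ Ioo 0 b, travelTime κ α (slope κ α (ξ y)) - y
      = travelTime κ α (slope κ α (ξ x)) - x := fun y hy =>
    isOpen_Ioo.is_const_of_deriv_eq_zero isPreconnected_Ioo
      (fun z hz => (hd z hz).differentiableAt.differentiableWithinAt)
      (fun z hz => (hd z hz).deriv) hy hx
  have hlim : Tendsto (fun y => travelTime κ α (slope κ α (ξ y)) - y) (𝓝[>] 0) (𝓝 (0 - 0)) :=
    ((tendsto_travelTime_atTop hκ hα).comp (h.tendsto_slope hκ)).sub
      (tendsto_id.mono_left nhdsWithin_le_nhds)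
  have hb : 0 < b := hx.1.trans hx.2
  have hlim' : Tendsto (fun y => travelTime κ α (slope κ α (ξ y)) - y) (𝓝[>] 0)
      (𝓝 (travelTime κ α (slope κ α (ξ x)) - x)) := by
    refine tendsto_const_nhds.congr' ?_
    filter_upwards [Ioo_mem_nhdsGT hb] with y hy
    exact (hconst y hy).symm
  have := tendsto_nhds_unique hlim hlim'
  linarith

/-- At a first zero `b` of `ξ` the slope would tend to `α`, hence the travel time to infinity,
whereas it equals the position and tends to `b`. -/
theorem pos (h : IsNormalProfile κ α ξ ξ') (hκ : 0 < κ) (hα : 0 ≤ α) {x : ℝ} (hx : 0 < x) :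
    0 < ξ x := by
  by_contra hneg
  set Z : Set ℝ := Ici 0 ∩ ξ ⁻¹' Iic 0 with hZ
  have hZc : IsClosed Z := h.continuousOn.preimage_isClosed_of_isClosed isClosed_Ici isClosed_Iic
  have hZne : Z.Nonempty := ⟨x, hx.le, not_lt.1 hneg⟩
  have hZb : BddBelow Z := ⟨0, fun y hy => hy.1⟩
  set b := sInf Z
  have hb : b ∈ Z := hZc.csInf_mem hZne hZb
  have hb0 : 0 < b := lt_of_le_of_ne hb.1 fun e => by
    have h1 : ξ b ≤ 0 := hb.2
    rw [← e] at h1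
    exact absurd (h.init_pos hκ) (not_lt.2 h1)
  have hpos : ∀ y ∈ Ioo 0 b, 0 < ξ y := fun y hy => by
    by_contra hy'
    exact absurd (csInf_le hZb (show y ∈ Z from ⟨hy.1.le, not_lt.1 hy'⟩)) (not_le.2 hy.2)
  have hcb : ContinuousAt ξ b := (h.hasDerivAt b hb0).continuousAt
  have hmem : ∀ᶠ y in 𝓝[<] b, y ∈ Ioo 0 b := Ioo_mem_nhdsLT hb0
  have hξb : ξ b = 0 := le_antisymm hb.2 (ge_of_tendsto (hcb.tendsto.mono_left nhdsWithin_le_nhds)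
    (hmem.mono fun y hy => (hpos y hy).le))
  have hsl : Tendsto (fun y => slope κ α (ξ y)) (𝓝[<] b) (𝓝[>] α) := by
    refine tendsto_nhdsWithin_iff.2 ⟨?_, hmem.mono fun y hy =>
      lt_slope hκ hα (hpos y hy) (h.one_sub_pos hκ hy.1)⟩
    have hcs : ContinuousAt (fun y => slope κ α (ξ y)) b := by
      unfold slope
      refine (ContinuousAt.div (by fun_prop) (by fun_prop) ?_).sqrt
      rw [hξb]
      norm_num
    have h1 := hcs.tendsto.mono_left (nhdsWithin_le_nhds (s := Iio b))
    have h2 : slope κ α (ξ b) = α := by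
      rw [slope, hξb]
      simp [Real.sqrt_sq hα]
    rwa [h2] at h1
  have h1 : Tendsto (fun y => travelTime κ α (slope κ α (ξ y))) (𝓝[<] b) atTop :=
    (tendsto_travelTime_nhdsGT hα).comp hsl
  have h2 : Tendsto (fun y => travelTime κ α (slope κ α (ξ y))) (𝓝[<] b) (𝓝 b) := by
    refine (tendsto_id.mono_left nhdsWithin_le_nhds).congr' ?_
    filter_upwards [hmem] with y hy
    exact (h.travelTime_slope_of_pos hκ hα hpos hy).symm
  exact not_tendsto_nhds_of_tendsto_atTop h1 _ h2

theorem deriv_eq (h : IsNormalProfile κ α ξ ξ') (hκ : 0 < κ) (hα : 0 ≤ α) {x : ℝ} (hx : 0 < x) :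
    ξ' x = -(slope κ α (ξ x) * ξ x) :=
  h.deriv_eq_of_pos hκ (fun _ hy => h.pos hκ hα hy.1) x ⟨hx, lt_add_one x⟩

theorem hasDerivAt_slope (h : IsNormalProfile κ α ξ ξ') (hκ : 0 < κ) (hα : 0 ≤ α) {x : ℝ}
    (hx : 0 < x) :
    HasDerivAt (fun x => slope κ α (ξ x)) (-((slope κ α (ξ x) ^ 2 - α ^ 2) *
      ((1 + κ * slope κ α (ξ x) ^ 2) / (2 * (1 + κ * α ^ 2))))) x :=
  h.hasDerivAt_slope_of_pos hκ hα (fun _ hy => h.pos hκ hα hy.1) ⟨hx, lt_add_one x⟩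

theorem travelTime_slope (h : IsNormalProfile κ α ξ ξ') (hκ : 0 < κ) (hα : 0 ≤ α) {x : ℝ}
    (hx : 0 < x) : travelTime κ α (slope κ α (ξ x)) = x :=
  h.travelTime_slope_of_pos hκ hα (fun _ hy => h.pos hκ hα hy.1) ⟨hx, lt_add_one x⟩

theorem lt_slope (h : IsNormalProfile κ α ξ ξ') (hκ : 0 < κ) (hα : 0 ≤ α) {x : ℝ} (hx : 0 < x) :
    α < slope κ α (ξ x) :=
  Cuspon.lt_slope hκ hα (h.pos hκ hα hx) (h.one_sub_pos hκ hx)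

end IsNormalProfile

end Cuspon

namespace Cuspon

/-! ### Smoothness and decay for autonomous equations -/

/-- Bootstrapping: if `f` is `C^n`, then so is its derivative `V ∘ f`, and `f` is `C^(n+1)`. -/
theorem contDiffOn_of_hasDerivAt_comp {E : Type*} [NormedAddCommGroup E] [NormedSpace ℝ E]
    {f : ℝ → E} {V : E → E} {I : Set ℝ} {U : Set E} (hI : IsOpen I)
    (hV : ContDiffOn ℝ ∞ V U) (hfU : MapsTo f I U) (hf : ∀ x ∈ I, HasDerivAt f (V (f x)) x) :
    ContDiffOn ℝ ∞ f I := by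
  rw [contDiffOn_infty]
  intro n
  induction n with
  | zero => exact contDiffOn_zero.2 fun x hx => (hf x hx).continuousAt.continuousWithinAt
  | succ n ih =>
    rw [Nat.cast_succ, contDiffOn_succ_iff_deriv_of_isOpen hI]
    refine ⟨fun x hx => (hf x hx).differentiableAt.differentiableWithinAt, by simp, ?_⟩
    refine ((hV.of_le (by exact_mod_cast le_top)).comp ih hfU).congr fun x hx => ?_
    exact (hf x hx).deriv

section Weight

variable {𝕜 : Type*} [NontriviallyNormedField 𝕜] [NormedAlgebra ℝ 𝕜]

/-- Iterated derivatives along an autonomous flow `r' = w₀(r) b(r)`, where differentiation raises the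
order of the weights `w j`. -/
theorem exists_iteratedDeriv_eq_weight {U : Set ℝ} (hU : IsOpen U) {r b : ℝ → ℝ} {w : ℕ → ℝ → ℝ}
    {k l : ℕ → ℝ → ℝ} (hrU : ∀ x, 0 < x → r x ∈ U) (hb : ContDiffOn ℝ ∞ b U)
    (hr : ∀ x, 0 < x → HasDerivAt r (w 0 (r x) * b (r x)) x)
    (hw : ∀ j, Differentiable ℝ (w j)) (hk : ∀ j, ContDiff ℝ ∞ (k j)) (hl : ∀ j, ContDiff ℝ ∞ (l j))
    (hwk : ∀ j s, deriv (w j) s * w 0 s = w (j + 1) s * k j s)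
    (hwl : ∀ j s, w j s * w 0 s = w (j + 1) s * l j s)
    {u h : ℝ → 𝕜} (hh : ContDiffOn ℝ ∞ h U)
    (hu : ∀ x, 0 < x → HasDerivAt u (w 0 (r x) • (h (r x) * u x)) x)
    {F H₀ : ℝ → 𝕜} (hH₀ : ContDiffOn ℝ ∞ H₀ U)
    (hF : ∀ x, 0 < x → F x = w 0 (r x) • (H₀ (r x) * u x)) (j : ℕ) :
    ∃ H : ℝ → 𝕜, ContDiffOn ℝ ∞ H U ∧
      ∀ x, 0 < x → iteratedDeriv j F x = w j (r x) • (H (r x) * u x) := by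
  induction j with
  | zero => exact ⟨H₀, hH₀, by simpa using hF⟩
  | succ j ih =>
    obtain ⟨H, hH, hj⟩ := ih
    have hH' := (contDiffOn_infty_iff_deriv_of_isOpen hU).1 hH
    -- The three terms come from differentiating the weight, the coefficient `H` and the function
    -- `u`. Each carries a factor `w 0`, which `hwk` and `hwl` convert into `w (j + 1)`.
    refine ⟨fun s => (k j s * b s) • H s + (l j s * b s) • deriv H s + l j s • (H s * h s),
      ((((hk j).contDiffOn.mul hb).smul hH).add (((hl j).contDiffOn.mul hb).smul hH'.2)).add
        ((hl j).contDiffOn.smul (hH.mul hh)), fun x hx => ?_⟩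
    rw [iteratedDeriv_succ]
    have e : iteratedDeriv j F =ᶠ[𝓝 x] fun x => w j (r x) • (H (r x) * u x) := by
      filter_upwards [Ioi_mem_nhds hx] with y hy using hj y hy
    rw [e.deriv_eq]
    have h1 : HasDerivAt (fun x => w j (r x)) (deriv (w j) (r x) * (w 0 (r x) * b (r x))) x :=
      ((hw j) (r x)).hasDerivAt.comp x (hr x hx)
    have h2 : HasDerivAt (fun x => H (r x)) ((w 0 (r x) * b (r x)) • deriv H (r x)) x :=
      ((hH'.1 _ (hrU x hx)).differentiableAt (hU.mem_nhds (hrU x hx))).hasDerivAt.scomp x (hr x hx)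
    have h3 := (h1.smul (h2.mul (hu x hx))).deriv
    refine h3.trans ?_
    have e1 := hwk j (r x)
    have e2 := hwl j (r x)
    rw [← mul_assoc, e1]
    calc _ = (w j (r x) * w 0 (r x)) • (b (r x) • (deriv H (r x) * u x) + H (r x) * h (r x) * u x)
          + (w (j + 1) (r x) * k j (r x) * b (r x)) • (H (r x) * u x) := by
          simp only [smul_mul_assoc, mul_smul_comm, mul_assoc]
          module
      _ = _ := by
          rw [e2]
          simp only [smul_mul_assoc, add_mul]
          module

end Weight

end Cuspon

/-! ### Cusp tails: slope equation, smoothness and phase -/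

namespace Cuspon

/-- Admissible parameters; `α` is the limiting slope `-η'/η` at infinity. -/
structure IsCuspParam (c κ α : ℝ) : Prop where
  pos : 0 < κ
  nonneg : 0 ≤ α
  ne : 2 * κ - 1 ≠ 0
  eqn : c ^ 2 - 2 = (2 * κ - 1) * α ^ 2

/-- A solution on `(0, ∞)` with vanishing first integrals starting from the critical set. -/
structure IsCuspTail (c κ : ℝ) (v g : ℝ → ℂ) : Prop where
  continuousOn : ContinuousOn v (Ici 0)
  init : ‖v 0‖ ^ 2 = 1 / (2 * κ)
  ne : ∀ x, 0 < x → ‖v x‖ ^ 2 ≠ 1 / (2 * κ)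
  curve : IsIntegralCurveOn c κ v g (Ioi 0)

/-- The normalised profile `η / (2κ - 1)`. -/
noncomputable def normalProfile (κ : ℝ) (v : ℝ → ℂ) (x : ℝ) : ℝ := intensity v x / (2 * κ - 1)

namespace IsCuspParam

variable {c κ α : ℝ}

/-- The sum could vanish only for `s = c = 0`; but `α = 0` forces `c² = 2`, and otherwise `s ≥ α >
0`. -/
theorem add_pos (hp : IsCuspParam c κ α) {s : ℝ} (hs : α ≤ s) : 0 < s ^ 2 + c ^ 2 := by
  have h1 : α ^ 2 ≤ s ^ 2 := pow_le_pow_left₀ hp.nonneg hs 2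
  rcases hp.nonneg.eq_or_lt with h | h
  · have := hp.eqn
    rw [← h] at this
    nlinarith [sq_nonneg s]
  · have : 0 < α ^ 2 := by positivity
    nlinarith [sq_nonneg c]

end IsCuspParam

namespace IsCuspTail

variable {c κ α : ℝ} {v g : ℝ → ℂ}

theorem intensity_eq (hp : IsCuspParam c κ α) (v : ℝ → ℂ) (x : ℝ) :
    intensity v x = (2 * κ - 1) * normalProfile κ v x :=
  (mul_div_cancel₀ _ hp.ne).symm

theorem hasDerivAt_normalProfile (h : IsCuspTail c κ v g) {x : ℝ} (hx : 0 < x) :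
    HasDerivAt (normalProfile κ v) (-2 * dot (v x) (g x) / (2 * κ - 1)) x :=
  (hasDerivAt_intensity (h.curve.hasDerivAt x hx)).div_const _

/-- Inserting momentum and energy into `|v|²|g|² = ⟨v,g⟩² + ⟨iv,g⟩²` gives `(1-2κ+2κη)η'² =
η²(2-c²-2η)`. Dividing `η` by `2κ-1` absorbs the sign that distinguishes the parameter regions. -/
theorem isNormalProfile (h : IsCuspTail c κ v g) (hp : IsCuspParam c κ α) :
    IsNormalProfile κ α (normalProfile κ v) (fun x => -2 * dot (v x) (g x) / (2 * κ - 1)) where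
  continuousOn := by
    unfold normalProfile intensity
    have := h.continuousOn
    fun_prop
  init := by
    have h1 := hp.ne
    have h2 := hp.pos.ne'
    rw [normalProfile, intensity, h.init]
    field_simp
  ne x hx e := by
    have h1 := hp.ne
    have h2 := hp.pos.ne'
    apply h.ne x hx
    have h3 := intensity_eq hp v x
    rw [intensity] at h3
    rw [eq_div_iff (by positivity)]
    linear_combination (-2 * κ) * h3 - (2 * κ - 1) * e
  hasDerivAt x hx := h.hasDerivAt_normalProfile hx
  continuousOn_deriv := (continuousOn_const.mul (ContinuousOn.dot
    (h.continuousOn.mono Ioi_subset_Ici_self) h.curve.continuousOn)).div_const _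
  eqn x hx := by
    have h1 := hp.ne
    have hm := h.curve.momentum x hx
    have he := h.curve.energy x hx
    have hn := norm_sq_mul_norm_sq (v x) (g x)
    rw [hm] at hn
    have hv : ‖v x‖ ^ 2 = 1 - intensity v x := by rw [intensity]; ring
    rw [hv] at hn
    have h3 := intensity_eq hp v x
    rw [h3] at hn he
    obtain ⟨t, ht⟩ : ∃ t, t = 2 * κ - 1 := ⟨_, rfl⟩
    obtain ⟨y, hy⟩ : ∃ y, y = normalProfile κ v x := ⟨_, rfl⟩
    obtain ⟨d, hd⟩ : ∃ d, d = dot (v x) (g x) := ⟨_, rfl⟩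
    have h4 := hp.eqn
    have hκ' : 2 * κ = t + 1 := by linarith
    simp only [← ht, ← hy, ← hd] at *
    have h5 : t * ((1 - 2 * κ * y) * (4 * d ^ 2)) = t * (t ^ 2 * (y ^ 2 * (α ^ 2 + 2 * y))) := by
      linear_combination (-2) * (1 - t * y) * he + 4 * hn + t ^ 2 * y ^ 2 * h4
        - (4 * d ^ 2) * hκ'
    have h6 := mul_left_cancel₀ h1 h5
    rw [div_pow, mul_pow, mul_div_assoc', div_eq_iff (pow_ne_zero 2 h1)]
    linarith

/-- The slope `-η'/η`. -/
noncomputable def rate (κ α : ℝ) (v : ℝ → ℂ) (x : ℝ) : ℝ := slope κ α (normalProfile κ v x)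

theorem lt_rate (h : IsCuspTail c κ v g) (hp : IsCuspParam c κ α) {x : ℝ} (hx : 0 < x) :
    α < rate κ α v x :=
  (h.isNormalProfile hp).lt_slope hp.pos hp.nonneg hx

theorem rate_pos (h : IsCuspTail c κ v g) (hp : IsCuspParam c κ α) {x : ℝ} (hx : 0 < x) :
    0 < rate κ α v x :=
  hp.nonneg.trans_lt (h.lt_rate hp hx)

theorem hasDerivAt_rate (h : IsCuspTail c κ v g) (hp : IsCuspParam c κ α) {x : ℝ} (hx : 0 < x) :
    HasDerivAt (rate κ α v) (-((rate κ α v x ^ 2 - α ^ 2) *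
      ((1 + κ * rate κ α v x ^ 2) / (2 * (1 + κ * α ^ 2))))) x :=
  (h.isNormalProfile hp).hasDerivAt_slope hp.pos hp.nonneg hx

theorem tendsto_rate (h : IsCuspTail c κ v g) (hp : IsCuspParam c κ α) :
    Tendsto (rate κ α v) (𝓝[>] 0) atTop :=
  (h.isNormalProfile hp).tendsto_slope hp.pos

theorem intensity_eq_rate (h : IsCuspTail c κ v g) (hp : IsCuspParam c κ α) {x : ℝ} (hx : 0 < x) :
    intensity v x = (rate κ α v x ^ 2 - α ^ 2) *
      ((2 * κ - 1) / (2 * (1 + κ * rate κ α v x ^ 2))) := by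
  have hn := h.isNormalProfile hp
  rw [intensity_eq hp, eq_slope (α := α) hp.pos (hn.pos hp.pos hp.nonneg hx).le
    (hn.one_sub_pos hp.pos hx), ← rate]
  ring

theorem one_sub_intensity (h : IsCuspTail c κ v g) (hp : IsCuspParam c κ α) {x : ℝ} (hx : 0 < x) :
    1 - intensity v x
      = (rate κ α v x ^ 2 + c ^ 2) / (2 * (1 + κ * rate κ α v x ^ 2)) := by
  have hκ := hp.pos
  have h2 : 0 < 1 + κ * rate κ α v x ^ 2 := by positivity
  rw [h.intensity_eq_rate hp hx]
  field_simp
  linear_combination -hp.eqn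

theorem one_sub_intensity_pos (h : IsCuspTail c κ v g) (hp : IsCuspParam c κ α) {x : ℝ}
    (hx : 0 < x) : 0 < 1 - intensity v x := by
  have hκ := hp.pos
  rw [h.one_sub_intensity hp hx]
  have := hp.add_pos (h.lt_rate hp hx).le
  positivity

theorem hasDerivAt_intensity_rate (h : IsCuspTail c κ v g) (hp : IsCuspParam c κ α) {x : ℝ}
    (hx : 0 < x) : HasDerivAt (intensity v) (-(rate κ α v x * intensity v x)) x := by
  have hd := (h.isNormalProfile hp).deriv_eq hp.pos hp.nonneg hx
  rw [div_eq_iff hp.ne] at hd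
  convert! hasDerivAt_intensity (h.curve.hasDerivAt x hx) using 1
  rw [hd, intensity_eq hp, rate]
  ring

/-- The derivative is recovered from its radial and angular parts, `|v|² g = (⟨v,g⟩ + i⟨iv,g⟩) v`,
which here are `rη/2` and `cη/2`. -/
theorem hasDerivAt_rate_smul (h : IsCuspTail c κ v g) (hp : IsCuspParam c κ α) {x : ℝ}
    (hx : 0 < x) : HasDerivAt v ((intensity v x / (2 * (1 - intensity v x)) : ℝ) *
      (rate κ α v x + Complex.I * c) * v x) x := by
  have hpos := h.one_sub_intensity_pos hp hx
  convert! h.curve.hasDerivAt x hx using 1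
  have hm := h.curve.momentum x hx
  have hd : dot (v x) (g x) = rate κ α v x * intensity v x / 2 := by
    have := (hasDerivAt_intensity (h.curve.hasDerivAt x hx)).unique
      (h.hasDerivAt_intensity_rate hp hx)
    linarith
  have hv : (v x).re ^ 2 + (v x).im ^ 2 = 1 - intensity v x := by
    rw [← norm_sq_eq_re_im, intensity]; ring
  rw [dot] at hd
  rw [cross] at hm
  have hne : (2 * (1 - intensity v x)) ≠ 0 := by positivity
  apply Complex.ext
  · rw [mul_assoc, Complex.re_ofReal_mul, div_mul_eq_mul_div, div_eq_iff hne, ← hv]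
    simp only [Complex.mul_re, Complex.add_re, Complex.add_im, Complex.ofReal_re,
      Complex.ofReal_im, Complex.mul_im, Complex.I_re, Complex.I_im]
    linear_combination (-2 * (v x).re) * hd + (2 * (v x).im) * hm
  · rw [mul_assoc, Complex.im_ofReal_mul, div_mul_eq_mul_div, div_eq_iff hne, ← hv]
    simp only [Complex.mul_re, Complex.add_re, Complex.add_im, Complex.ofReal_re,
      Complex.ofReal_im, Complex.mul_im, Complex.I_re, Complex.I_im]
    linear_combination (-2 * (v x).im) * hd - (2 * (v x).re) * hm

/-- The logarithmic derivative of the solution as a function of the slope, up to the factor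
`s² - α²`. -/
noncomputable def logDeriv (c κ s : ℝ) : ℂ :=
  ((2 * κ - 1) / (2 * (s ^ 2 + c ^ 2)) : ℝ) • ((s : ℂ) + Complex.I * c)

/-- The factor `r² - α²`, which carries the decay, is split off; the remaining coefficient is a
function of the slope that stays smooth down to the equilibrium `α`. -/
theorem hasDerivAt_logDeriv (h : IsCuspTail c κ v g) (hp : IsCuspParam c κ α) {x : ℝ}
    (hx : 0 < x) : HasDerivAt v
      ((rate κ α v x ^ 2 - α ^ 2) • (logDeriv c κ (rate κ α v x) * v x)) x := by
  convert! h.hasDerivAt_rate_smul hp hx using 1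
  have hκ := hp.pos
  have h2 : 0 < 1 + κ * rate κ α v x ^ 2 := by positivity
  have h3 := hp.add_pos (h.lt_rate hp hx).le
  have e : intensity v x / (2 * (1 - intensity v x)) = (rate κ α v x ^ 2 - α ^ 2) *
      ((2 * κ - 1) / (2 * (rate κ α v x ^ 2 + c ^ 2))) := by
    rw [h.one_sub_intensity hp hx, h.intensity_eq_rate hp hx]
    field_simp
  rw [e, logDeriv, Complex.real_smul, Complex.real_smul, Complex.ofReal_mul]
  ring

/-- The set on which the coefficients of the equation for the slope are smooth. -/
def regular (c : ℝ) : Set ℝ := {s | s ^ 2 + c ^ 2 ≠ 0}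

theorem isOpen_regular (c : ℝ) : IsOpen (regular c) :=
  isOpen_ne_fun (by fun_prop) continuous_const

theorem rate_mem_regular (h : IsCuspTail c κ v g) (hp : IsCuspParam c κ α) {x : ℝ}
    (hx : 0 < x) : rate κ α v x ∈ regular c :=
  (hp.add_pos (h.lt_rate hp hx).le).ne'

theorem contDiffOn_logDeriv (c κ : ℝ) : ContDiffOn ℝ ∞ (logDeriv c κ) (regular c) := by
  unfold logDeriv
  have h1 : ContDiffOn ℝ ∞ (fun s : ℝ => (2 * κ - 1) / (2 * (s ^ 2 + c ^ 2))) (regular c) :=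
    contDiffOn_const.div (ContDiff.contDiffOn (by fun_prop)) fun s hs => mul_ne_zero two_ne_zero hs
  have h2 : ContDiff ℝ ∞ (fun s : ℝ => (s : ℂ) + Complex.I * c) :=
    Complex.ofRealCLM.contDiff.add contDiff_const
  exact h1.smul h2.contDiffOn

theorem contDiff_div_one_add {κ : ℝ} (hκ : 0 < κ) (t : ℝ) :
    ContDiff ℝ ∞ fun s : ℝ => t / (2 * (1 + κ * s ^ 2)) :=
  contDiff_const.div (by fun_prop) fun s => by positivity

/-- The equation for `v` alone has coefficients depending on `x`; the pair `(rate, v)` solves an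
autonomous system with smooth coefficients. -/
theorem contDiffOn (h : IsCuspTail c κ v g) (hp : IsCuspParam c κ α) :
    ContDiffOn ℝ ∞ v (Ioi 0) := by
  have hr : ContDiffOn ℝ ∞ (rate κ α v) (Ioi 0) :=
    contDiffOn_of_hasDerivAt_comp (U := univ) (V := fun s => -((s ^ 2 - α ^ 2) *
      ((1 + κ * s ^ 2) / (2 * (1 + κ * α ^ 2))))) isOpen_Ioi
      (ContDiff.contDiffOn (by fun_prop)) (fun _ _ => mem_univ _)
      fun x hx => h.hasDerivAt_rate hp hx
  have hsys : ContDiffOn ℝ ∞ (fun x => (rate κ α v x, v x)) (Ioi 0) := by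
    refine contDiffOn_of_hasDerivAt_comp (U := regular c ×ˢ univ)
      (V := fun p : ℝ × ℂ => (-((p.1 ^ 2 - α ^ 2) * ((1 + κ * p.1 ^ 2) / (2 * (1 + κ * α ^ 2)))),
        (p.1 ^ 2 - α ^ 2) • (logDeriv c κ p.1 * p.2))) isOpen_Ioi ?_
      (fun x hx => ⟨h.rate_mem_regular hp hx, mem_univ _⟩)
      fun x hx => (h.hasDerivAt_rate hp hx).prodMk (h.hasDerivAt_logDeriv hp hx)
    have h1 : ContDiff ℝ ∞ fun p : ℝ × ℂ =>
        -((p.1 ^ 2 - α ^ 2) * ((1 + κ * p.1 ^ 2) / (2 * (1 + κ * α ^ 2)))) := by fun_prop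
    have h2 : ContDiff ℝ ∞ fun p : ℝ × ℂ => p.1 ^ 2 - α ^ 2 := by fun_prop
    have h3 : ContDiffOn ℝ ∞ (fun p : ℝ × ℂ => logDeriv c κ p.1) (regular c ×ˢ univ) :=
      (contDiffOn_logDeriv c κ).comp contDiff_fst.contDiffOn fun p hp => hp.1
    exact h1.contDiffOn.prodMk (h2.contDiffOn.smul (h3.mul contDiff_snd.contDiffOn))
  exact contDiff_snd.comp_contDiffOn hsys

/-- Polar form. -/
theorem exists_phase (h : IsCuspTail c κ v g) (hp : IsCuspParam c κ α) :
    ∃ θ : ℝ → ℝ, ∀ x, 0 < x →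
      v x = (√(1 - intensity v x) : ℂ) * Complex.exp (Complex.I * (θ x : ℂ)) ∧
      HasDerivAt θ (c * intensity v x / (2 - 2 * intensity v x)) x := by
  have hcη : ContinuousOn (intensity v) (Ioi 0) := fun x hx =>
    (h.hasDerivAt_intensity_rate hp hx).continuousAt.continuousWithinAt
  have hcf : ContinuousOn (fun x => c * intensity v x / (2 - 2 * intensity v x)) (Ioi 0) :=
    (continuousOn_const.mul hcη).div (continuousOn_const.sub (continuousOn_const.mul hcη))
      fun x hx => by linarith [h.one_sub_intensity_pos hp hx]
  set ϑ : ℝ → ℝ := fun x => ∫ t in (1 : ℝ)..x, c * intensity v t / (2 - 2 * intensity v t)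
  have hϑ : ∀ x, 0 < x → HasDerivAt ϑ (c * intensity v x / (2 - 2 * intensity v x)) x := by
    intro x hx
    refine intervalIntegral.integral_hasDerivAt_right ?_ ?_ (hcf.continuousAt (Ioi_mem_nhds hx))
    · refine (hcf.mono fun y hy => ?_).intervalIntegrable
      exact (lt_min one_pos hx).trans_le hy.1
    · exact hcf.stronglyMeasurableAtFilter isOpen_Ioi x hx
  -- `Q` is the quotient of `v` by the expected polar form. It is constant of modulus one, so its
  -- argument is the missing constant in the phase.
  set Q : ℝ → ℂ := fun x => v x * Complex.exp (-Complex.I * (ϑ x : ℂ)) *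
    (((√(1 - intensity v x))⁻¹ : ℝ) : ℂ)
  have hQ : ∀ x, 0 < x → HasDerivAt Q 0 x := by
    intro x hx
    have hpos := h.one_sub_intensity_pos hp hx
    have hs : 0 < √(1 - intensity v x) := Real.sqrt_pos.2 hpos
    have hss : √(1 - intensity v x) ^ 2 = 1 - intensity v x := Real.sq_sqrt hpos.le
    have h1 := (((h.hasDerivAt_intensity_rate hp hx).const_sub 1).sqrt hpos.ne').inv hs.ne'
    have h2 := ((hϑ x hx).ofReal_comp.const_mul (-Complex.I)).cexp
    convert! ((h.hasDerivAt_rate_smul hp hx).mul h2).mul h1.ofReal_comp using 1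
    have hd : c * intensity v x / (2 - 2 * intensity v x)
        = c * (intensity v x / (2 * (1 - intensity v x))) := by
      rw [mul_sub, mul_one, mul_div_assoc]
    have hi : -(- -(rate κ α v x * intensity v x) / (2 * √(1 - intensity v x)))
          / √(1 - intensity v x) ^ 2
        = -(intensity v x / (2 * (1 - intensity v x)) * rate κ α v x)
          * (√(1 - intensity v x))⁻¹ := by
      rw [hss]
      field_simp
    rw [hd, hi]
    simp only [Pi.mul_apply, Pi.inv_apply]
    push_cast
    ring
  have hconst : ∀ x, 0 < x → Q x = Q 1 := fun x hx =>
    isOpen_Ioi.is_const_of_deriv_eq_zero isPreconnected_Ioi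
      (fun z hz => (hQ z hz).differentiableAt.differentiableWithinAt)
      (fun z hz => (hQ z hz).deriv) hx (mem_Ioi.2 one_pos)
  have hnorm : ∀ x, ‖v x‖ = √(1 - intensity v x) := fun x => by
    rw [intensity, sub_sub_cancel, Real.sqrt_sq (norm_nonneg _)]
  have hQ1 : ‖Q 1‖ = 1 := by
    have hs : 0 < √(1 - intensity v 1) := Real.sqrt_pos.2 (h.one_sub_intensity_pos hp one_pos)
    simp only [Q]
    rw [norm_mul, norm_mul, hnorm, show -Complex.I * (ϑ 1 : ℂ) = ((-ϑ 1 : ℝ) : ℂ) * Complex.I by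
      push_cast; ring, Complex.norm_exp_ofReal_mul_I, Complex.norm_real,
      Real.norm_of_nonneg (inv_nonneg.2 hs.le), mul_one, mul_inv_cancel₀ hs.ne']
  refine ⟨fun x => ϑ x + (Q 1).arg, fun x hx => ⟨?_, (hϑ x hx).add_const _⟩⟩
  have hs : 0 < √(1 - intensity v x) := Real.sqrt_pos.2 (h.one_sub_intensity_pos hp hx)
  have hsc : (√(1 - intensity v x) : ℂ) ≠ 0 := by exact_mod_cast hs.ne'
  have e1 : Q 1 = Complex.exp (Complex.I * ((Q 1).arg : ℂ)) := by
    have := Complex.norm_mul_exp_arg_mul_I (Q 1)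
    rw [hQ1, Complex.ofReal_one, one_mul, mul_comm] at this
    exact this.symm
  have e2 : Complex.exp (Complex.I * (ϑ x : ℂ)) * Complex.exp (-(Complex.I * (ϑ x : ℂ))) = 1 := by
    rw [← Complex.exp_add]
    simp
  rw [Complex.ofReal_add, mul_add, Complex.exp_add, ← e1, ← hconst x hx]
  simp only [Q, neg_mul]
  rw [Complex.ofReal_inv]
  field_simp
  linear_combination (-v x) * e2

end IsCuspTail

end Cuspon

/-! ### Decay of the slope and of all derivatives -/

namespace Cuspon

namespace IsCuspTail

variable {c κ α : ℝ} {v g : ℝ → ℂ}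

theorem rate_antitone (h : IsCuspTail c κ v g) (hp : IsCuspParam c κ α) :
    AntitoneOn (rate κ α v) (Ioi 0) := by
  refine antitoneOn_of_deriv_nonpos (convex_Ioi 0)
    (fun x hx => (h.hasDerivAt_rate hp hx).continuousAt.continuousWithinAt)
    (fun x hx => ?_) fun x hx => ?_
  · rw [interior_Ioi] at hx
    exact (h.hasDerivAt_rate hp hx).differentiableAt.differentiableWithinAt
  · rw [interior_Ioi] at hx
    have hκ := hp.pos
    have hr := h.lt_rate hp hx
    have h0 := hp.nonneg
    have h1 : 0 ≤ rate κ α v x ^ 2 - α ^ 2 := by nlinarith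
    rw [(h.hasDerivAt_rate hp hx).deriv, neg_nonpos]
    positivity

/-- Exponential convergence of the slope if `α > 0`. -/
theorem rate_sq_sub_le (h : IsCuspTail c κ v g) (hp : IsCuspParam c κ α) {x : ℝ} (hx : 1 ≤ x) :
    rate κ α v x ^ 2 - α ^ 2
      ≤ (rate κ α v 1 ^ 2 - α ^ 2) * Real.exp α * Real.exp (-α * x) := by
  have hκ := hp.pos
  -- The quantity `r² - α²` decays at the relative rate `r(1+κr²)/(1+κα²)`, which is at least `α`
  -- because `r > α`.
  have hd : ∀ y, 0 < y → HasDerivAt (fun y => (rate κ α v y ^ 2 - α ^ 2) * Real.exp (α * y))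
      ((rate κ α v y ^ 2 - α ^ 2) * Real.exp (α * y) *
        (α - rate κ α v y * ((1 + κ * rate κ α v y ^ 2) / (1 + κ * α ^ 2)))) y := by
    intro y hy
    convert! (((h.hasDerivAt_rate hp hy).pow 2).sub_const (α ^ 2)).mul
      (((hasDerivAt_id y).const_mul α).exp) using 1
    have h6 : 0 < 1 + κ * α ^ 2 := by positivity
    simp only [Nat.cast_ofNat, Nat.add_one_sub_one, pow_one, Pi.pow_apply, id]
    field_simp
    ring
  have hanti : AntitoneOn (fun y => (rate κ α v y ^ 2 - α ^ 2) * Real.exp (α * y)) (Ioi 0) := by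
    refine antitoneOn_of_deriv_nonpos (convex_Ioi 0)
      (fun x hx => (hd x hx).continuousAt.continuousWithinAt) (fun x hx => ?_) fun x hx => ?_
    · rw [interior_Ioi] at hx
      exact (hd x hx).differentiableAt.differentiableWithinAt
    · rw [interior_Ioi] at hx
      have hr := h.lt_rate hp hx
      have h0 := hp.nonneg
      have h1 : 0 ≤ rate κ α v x ^ 2 - α ^ 2 := by nlinarith
      have h6 : 0 < 1 + κ * α ^ 2 := by positivity
      have h2 : 1 ≤ (1 + κ * rate κ α v x ^ 2) / (1 + κ * α ^ 2) := by
        rw [one_le_div h6]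
        nlinarith
      rw [(hd x hx).deriv]
      refine mul_nonpos_of_nonneg_of_nonpos (mul_nonneg h1 (Real.exp_pos _).le) ?_
      nlinarith
  have h1 := hanti (mem_Ioi.2 one_pos) (mem_Ioi.2 (one_pos.trans_le hx)) hx
  simp only [mul_one] at h1
  have h2 := mul_le_mul_of_nonneg_right h1 (Real.exp_pos (-α * x)).le
  rwa [mul_assoc, ← Real.exp_add, show α * x + -α * x = 0 by ring, Real.exp_zero, mul_one] at h2

/-- Algebraic convergence of the slope if `α = 0`. -/
theorem rate_le_two_div (h : IsCuspTail c κ v g) (hp : IsCuspParam c κ 0) {x : ℝ} (hx : 0 < x) :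
    rate κ 0 v x ≤ 2 / x := by
  have hκ := hp.pos
  -- For `α = 0`, `(1/r)' = (1+κr²)/2 ≥ 1/2`, while `1/r` is positive near the cusp; hence `1/r ≥
  -- x/2`.
  have hd : ∀ y, 0 < y → HasDerivAt (fun y => (rate κ 0 v y)⁻¹ - y / 2)
      (κ * rate κ 0 v y ^ 2 / 2) y := by
    intro y hy
    have hr := h.rate_pos hp hy
    convert! ((h.hasDerivAt_rate hp hy).inv hr.ne').sub ((hasDerivAt_id y).div_const 2) using 1
    field_simp
    ring
  have hmono : MonotoneOn (fun y => (rate κ 0 v y)⁻¹ - y / 2) (Ioi 0) := by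
    refine monotoneOn_of_deriv_nonneg (convex_Ioi 0)
      (fun x hx => (hd x hx).continuousAt.continuousWithinAt) (fun x hx => ?_) fun x hx => ?_
    · rw [interior_Ioi] at hx
      exact (hd x hx).differentiableAt.differentiableWithinAt
    · rw [interior_Ioi] at hx
      rw [(hd x hx).deriv]
      positivity
  have hr := h.rate_pos hp hx
  have h1 : 0 ≤ (rate κ 0 v x)⁻¹ - x / 2 := by
    have hlim : Tendsto (fun y : ℝ => -(y / 2)) (𝓝[>] 0) (𝓝 (-(0 / 2))) :=
      (Continuous.tendsto (by fun_prop) 0).mono_left nhdsWithin_le_nhds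
    rw [zero_div, neg_zero] at hlim
    refine le_of_tendsto hlim ?_
    filter_upwards [Ioo_mem_nhdsGT hx] with y hy
    have h2 := hmono hy.1 hx hy.2.le
    have h3 : 0 < (rate κ 0 v y)⁻¹ := inv_pos.2 (h.rate_pos hp hy.1)
    simp only at h2
    linarith
  rw [le_div_iff₀ hx]
  have h2 : x / 2 ≤ (rate κ 0 v x)⁻¹ := by linarith
  have h3 := mul_le_mul_of_nonneg_left h2 hr.le
  rw [mul_inv_cancel₀ hr.ne'] at h3
  linarith

theorem exists_norm_le (h : IsCuspTail c κ v g) (hp : IsCuspParam c κ α) :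
    ∃ M, ∀ x, 0 < x → ‖v x‖ ≤ M := by
  -- This number bounds `‖v‖²`, and therefore `‖v‖`, since it is at least one.
  refine ⟨1 + |2 * κ - 1| / (2 * κ), fun x hx => ?_⟩
  have hκ := hp.pos
  have hn := h.isNormalProfile hp
  have h1 := hn.pos hp.pos hp.nonneg hx
  have h2 := hn.one_sub_pos hp.pos hx
  have h3 : |intensity v x| ≤ |2 * κ - 1| / (2 * κ) := by
    rw [intensity_eq hp, abs_mul, abs_of_pos h1, div_eq_mul_inv]
    refine mul_le_mul_of_nonneg_left ?_ (abs_nonneg _)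
    rw [← one_div, le_div_iff₀ (by positivity)]
    linarith
  have h4 : ‖v x‖ ^ 2 ≤ 1 + |2 * κ - 1| / (2 * κ) := by
    have := (abs_le.1 h3).1
    rw [intensity] at this
    linarith
  have h5 : 0 ≤ |2 * κ - 1| / (2 * κ) := by positivity
  by_contra! h6
  nlinarith

/-- For `x ≥ 1` the slope stays in the compact interval `[α, rate 1]`, which lies in the regular set
together with its endpoint `α`. -/
theorem exists_bound_comp_rate {E : Type*} [NormedAddCommGroup E] (h : IsCuspTail c κ v g)
    (hp : IsCuspParam c κ α) {H : ℝ → E} (hH : ContinuousOn H (regular c)) :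
    ∃ M, 0 ≤ M ∧ ∀ x, 1 ≤ x → ‖H (rate κ α v x)‖ ≤ M := by
  obtain ⟨M, hM⟩ := (isCompact_Icc (a := α) (b := rate κ α v 1)).exists_bound_of_continuousOn
    (hH.mono fun s hs => (hp.add_pos hs.1).ne')
  have hmem : ∀ x, 1 ≤ x → rate κ α v x ∈ Icc α (rate κ α v 1) := fun x hx =>
    ⟨(h.lt_rate hp (one_pos.trans_le hx)).le,
      h.rate_antitone hp (mem_Ioi.2 one_pos) (mem_Ioi.2 (one_pos.trans_le hx)) hx⟩
  exact ⟨M, (norm_nonneg _).trans (hM _ (hmem 1 le_rfl)), fun x hx => hM _ (hmem x hx)⟩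

/-- All derivatives of `u'` and `η` are controlled by the weights of the slope. -/
theorem exists_iteratedDeriv_le (h : IsCuspTail c κ v g) (hp : IsCuspParam c κ α)
    {w k l : ℕ → ℝ → ℝ} (hw0 : ∀ s, w 0 s = s ^ 2 - α ^ 2) (hwn : ∀ j s, α ≤ s → 0 ≤ w j s)
    (hw : ∀ j, Differentiable ℝ (w j)) (hk : ∀ j, ContDiff ℝ ∞ (k j)) (hl : ∀ j, ContDiff ℝ ∞ (l j))
    (hwk : ∀ j s, deriv (w j) s * w 0 s = w (j + 1) s * k j s)
    (hwl : ∀ j s, w j s * w 0 s = w (j + 1) s * l j s) (j : ℕ) :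
    ∃ M, 0 ≤ M ∧ ∀ x, 1 ≤ x →
      ‖iteratedDeriv j (deriv v) x‖ + |iteratedDeriv j (intensity v) x|
        ≤ M * w j (rate κ α v x) := by
  have hκ := hp.pos
  have hrU : ∀ x, 0 < x → rate κ α v x ∈ regular c := fun x hx => h.rate_mem_regular hp hx
  have hb : ContDiffOn ℝ ∞ (fun s : ℝ => -((1 + κ * s ^ 2) / (2 * (1 + κ * α ^ 2)))) (regular c) :=
    ContDiff.contDiffOn (by fun_prop)
  have hr : ∀ x, 0 < x → HasDerivAt (rate κ α v) (w 0 (rate κ α v x) *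
      -((1 + κ * rate κ α v x ^ 2) / (2 * (1 + κ * α ^ 2)))) x := fun x hx => by
    rw [hw0, mul_neg]
    exact h.hasDerivAt_rate hp hx
  obtain ⟨H, hH, hHx⟩ := exists_iteratedDeriv_eq_weight (isOpen_regular c) hrU hb hr hw hk hl hwk hwl
    (contDiffOn_logDeriv c κ)
    (fun x hx => by rw [hw0]; exact h.hasDerivAt_logDeriv hp hx)
    (contDiffOn_logDeriv c κ) (F := deriv v)
    (fun x hx => by rw [hw0]; exact (h.hasDerivAt_logDeriv hp hx).deriv) j
  -- The profile is a function of the slope alone, so the companion function is the constant one.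
  obtain ⟨G, hG, hGx⟩ := exists_iteratedDeriv_eq_weight (isOpen_regular c) hrU hb hr hw hk hl hwk hwl
    (u := fun _ => (1 : ℝ)) (h := fun _ => (0 : ℝ)) contDiffOn_const
    (fun x hx => by simpa using hasDerivAt_const x (1 : ℝ))
    (contDiff_div_one_add hκ (2 * κ - 1)).contDiffOn (F := intensity v)
    (fun x hx => by rw [hw0, smul_eq_mul, mul_one]; exact h.intensity_eq_rate hp hx) j
  obtain ⟨M₁, hM₁, hM₁x⟩ := h.exists_bound_comp_rate hp hH.continuousOn
  obtain ⟨M₂, hM₂, hM₂x⟩ := h.exists_bound_comp_rate hp hG.continuousOn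
  obtain ⟨M₃, hM₃x⟩ := h.exists_norm_le hp
  have hM₃ : 0 ≤ M₃ := (norm_nonneg _).trans (hM₃x 1 one_pos)
  refine ⟨M₁ * M₃ + M₂, by positivity, fun x hx => ?_⟩
  have hx0 : 0 < x := one_pos.trans_le hx
  have hwx := hwn j _ (h.lt_rate hp hx0).le
  rw [hHx x hx0, hGx x hx0, norm_smul, norm_mul, Real.norm_of_nonneg hwx, smul_eq_mul, mul_one,
    abs_mul, abs_of_nonneg hwx, ← mul_add, mul_comm]
  refine mul_le_mul_of_nonneg_right (add_le_add ?_ (hM₂x x hx)) hwx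
  exact mul_le_mul (hM₁x x hx) (hM₃x x hx0) (norm_nonneg _) hM₁

theorem exponential_decay (h : IsCuspTail c κ v g) (hp : IsCuspParam c κ α) (hα : 0 < α) (j : ℕ) :
    ∃ C₁ C₂ : ℝ, 0 < C₁ ∧ 0 < C₂ ∧ ∀ x, 1 ≤ x →
      ‖iteratedDeriv j (deriv v) x‖ + |iteratedDeriv j (intensity v) x|
        ≤ C₁ * Real.exp (-C₂ * x) := by
  -- Differentiation keeps a factor `s² - α²` but gains no further smallness when `α > 0`, so one
  -- weight serves all orders.
  obtain ⟨M, hM, hMx⟩ := h.exists_iteratedDeriv_le hp (w := fun _ s => s ^ 2 - α ^ 2)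
    (k := fun _ s => 2 * s) (l := fun _ s => s ^ 2 - α ^ 2) (fun s => rfl)
    (fun j s hs => sub_nonneg.2 (pow_le_pow_left₀ hα.le hs 2)) (fun j => by fun_prop)
    (fun j => by fun_prop) (fun j => by fun_prop)
    (fun j s => by simp; ring) (fun j s => rfl) j
  have h1 := h.lt_rate hp one_pos
  have h2 : 0 < rate κ α v 1 ^ 2 - α ^ 2 := by nlinarith
  refine ⟨(M + 1) * ((rate κ α v 1 ^ 2 - α ^ 2) * Real.exp α), α, by positivity, hα,
    fun x hx => (hMx x hx).trans ?_⟩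
  have h3 := h.rate_sq_sub_le hp hx
  have h4 : 0 ≤ (rate κ α v 1 ^ 2 - α ^ 2) * Real.exp α * Real.exp (-α * x) := by positivity
  calc M * (rate κ α v x ^ 2 - α ^ 2)
      ≤ M * ((rate κ α v 1 ^ 2 - α ^ 2) * Real.exp α * Real.exp (-α * x)) :=
        mul_le_mul_of_nonneg_left h3 hM
    _ ≤ _ := by linarith

theorem algebraic_decay (h : IsCuspTail c κ v g) (hp : IsCuspParam c κ 0) (j : ℕ) :
    ∃ C₃ : ℝ, 0 < C₃ ∧ ∀ x, 1 ≤ x →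
      ‖iteratedDeriv j (deriv v) x‖ + |iteratedDeriv j (intensity v) x|
        ≤ C₃ * x ^ (-(2 + (j : ℤ))) := by
  -- Here `r'` is of order `r²`, so each derivative gains one power of the slope.
  obtain ⟨M, hM, hMx⟩ := h.exists_iteratedDeriv_le hp (w := fun j s => s ^ (j + 2))
    (k := fun j _ => (j : ℝ) + 2) (l := fun _ s => s) (fun s => by simp)
    (fun j s hs => pow_nonneg hs _) (fun j => by fun_prop)
    (fun j => by fun_prop) (fun j => by fun_prop)
    (fun j s => by simp; ring) (fun j s => by ring) j
  refine ⟨(M + 1) * 2 ^ (j + 2), by positivity, fun x hx => (hMx x hx).trans ?_⟩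
  have hx0 : 0 < x := one_pos.trans_le hx
  have h1 : rate κ 0 v x ^ (j + 2) ≤ (2 / x) ^ (j + 2) :=
    pow_le_pow_left₀ (h.rate_pos hp hx0).le (h.rate_le_two_div hp hx0) _
  have h2 : (2 / x) ^ (j + 2) = 2 ^ (j + 2) * x ^ (-(2 + (j : ℤ))) := by
    rw [div_pow, div_eq_mul_inv, zpow_neg, show (2 + (j : ℤ)) = ((j + 2 : ℕ) : ℤ) by push_cast; ring,
      zpow_natCast]
  rw [h2] at h1
  have h4 : 0 ≤ 2 ^ (j + 2) * x ^ (-(2 + (j : ℤ))) := by positivity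
  calc M * rate κ 0 v x ^ (j + 2) ≤ M * (2 ^ (j + 2) * x ^ (-(2 + (j : ℤ)))) :=
        mul_le_mul_of_nonneg_left h1 hM
    _ ≤ _ := by linarith

/-! ### Range, one-sided derivatives and the inverse profile -/

theorem intensity_init (h : IsCuspTail c κ v g) : intensity v 0 = 1 - 1 / (2 * κ) := by
  rw [intensity, h.init]

theorem normalProfile_mem (h : IsCuspTail c κ v g) (hp : IsCuspParam c κ α) {x : ℝ} (hx : 0 < x) :
    0 < normalProfile κ v x ∧ 2 * κ * normalProfile κ v x < 1 :=
  ⟨(h.isNormalProfile hp).pos hp.pos hp.nonneg hx,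
    by linarith [(h.isNormalProfile hp).one_sub_pos hp.pos hx]⟩

theorem range_of_lt (h : IsCuspTail c κ v g) (hp : IsCuspParam c κ α) (ht : 2 * κ - 1 < 0) {x : ℝ}
    (hx : 0 < x) : 1 - 1 / (2 * κ) < intensity v x ∧ intensity v x < 0 := by
  obtain ⟨h1, h2⟩ := h.normalProfile_mem hp hx
  have hκ := hp.pos
  rw [intensity_eq hp]
  refine ⟨?_, mul_neg_of_neg_of_pos ht h1⟩
  rw [show 1 - 1 / (2 * κ) = (2 * κ - 1) * (1 / (2 * κ)) by field_simp]
  refine mul_lt_mul_of_neg_left ?_ ht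
  rw [lt_div_iff₀ (by positivity)]
  linarith

theorem range_of_gt (h : IsCuspTail c κ v g) (hp : IsCuspParam c κ α) (ht : 0 < 2 * κ - 1) {x : ℝ}
    (hx : 0 < x) : 0 < intensity v x ∧ intensity v x < 1 - 1 / (2 * κ) := by
  obtain ⟨h1, h2⟩ := h.normalProfile_mem hp hx
  have hκ := hp.pos
  rw [intensity_eq hp]
  refine ⟨mul_pos ht h1, ?_⟩
  rw [show 1 - 1 / (2 * κ) = (2 * κ - 1) * (1 / (2 * κ)) by field_simp]
  refine mul_lt_mul_of_pos_left ?_ ht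
  rw [lt_div_iff₀ (by positivity)]
  linarith

theorem deriv_intensity_eventuallyEq (h : IsCuspTail c κ v g) (hp : IsCuspParam c κ α) :
    deriv (intensity v) =ᶠ[𝓝[>] 0] fun x => rate κ α v x * -intensity v x := by
  filter_upwards [self_mem_nhdsWithin] with x hx
  rw [(h.hasDerivAt_intensity_rate hp hx).deriv]
  ring

theorem tendsto_intensity (h : IsCuspTail c κ v g) :
    Tendsto (intensity v) (𝓝[>] 0) (𝓝 (1 - 1 / (2 * κ))) := by
  rw [← h.intensity_init]
  have hc : ContinuousOn (intensity v) (Ici 0) := by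
    have := h.continuousOn
    unfold intensity
    fun_prop
  exact (hc 0 self_mem_Ici).tendsto.mono_left (nhdsWithin_mono _ Ioi_subset_Ici_self)

/-- In `η' = -rη` the slope tends to infinity at the cusp while `η` tends to `1 - 1/(2κ)`, which is
nonzero with the sign of `2κ - 1`. -/
theorem tendsto_deriv_of_lt (h : IsCuspTail c κ v g) (hp : IsCuspParam c κ α) (ht : 2 * κ - 1 < 0) :
    Tendsto (deriv (intensity v)) (𝓝[>] 0) atTop := by
  refine ((h.tendsto_rate hp).atTop_mul_pos (C := -(1 - 1 / (2 * κ))) ?_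
    h.tendsto_intensity.neg).congr' (h.deriv_intensity_eventuallyEq hp).symm
  have hκ := hp.pos
  rw [show -(1 - 1 / (2 * κ)) = -(2 * κ - 1) * (1 / (2 * κ)) by field_simp]
  exact mul_pos (by linarith) (by positivity)

theorem tendsto_deriv_of_gt (h : IsCuspTail c κ v g) (hp : IsCuspParam c κ α) (ht : 0 < 2 * κ - 1) :
    Tendsto (deriv (intensity v)) (𝓝[>] 0) atBot := by
  refine ((h.tendsto_rate hp).atTop_mul_neg (C := -(1 - 1 / (2 * κ))) ?_
    h.tendsto_intensity.neg).congr' (h.deriv_intensity_eventuallyEq hp).symm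
  have hκ := hp.pos
  rw [show -(1 - 1 / (2 * κ)) = -(2 * κ - 1) * (1 / (2 * κ)) by field_simp]
  exact mul_neg_of_neg_of_pos (by linarith) (by positivity)

end IsCuspTail

theorem slope_injOn {κ α ξ ζ : ℝ} (hκ : 0 < κ) (h0 : 0 < ξ) (h1 : 2 * κ * ξ < 1)
    (h0' : 0 < ζ) (h1' : 2 * κ * ζ < 1) (h : slope κ α ξ = slope κ α ζ) : ξ = ζ := by
  rw [eq_slope (α := α) hκ h0.le (by linarith), eq_slope (α := α) hκ h0'.le (by linarith), h]

namespace IsCuspTail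

variable {c κ α : ℝ} {v g : ℝ → ℂ}

/-- Two cusp tails have the same profile. -/
theorem intensity_unique (h : IsCuspTail c κ v g) {v' g' : ℝ → ℂ} (h' : IsCuspTail c κ v' g')
    (hp : IsCuspParam c κ α) {x : ℝ} (hx : 0 ≤ x) : intensity v x = intensity v' x := by
  rcases hx.eq_or_lt with rfl | hx
  · rw [h.intensity_init, h'.intensity_init]
  · have h1 := h.normalProfile_mem hp hx
    have h2 := h'.normalProfile_mem hp hx
    have h3 := (h.isNormalProfile hp).travelTime_slope hp.pos hp.nonneg hx
    have h4 := (h'.isNormalProfile hp).travelTime_slope hp.pos hp.nonneg hx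
    rw [intensity_eq hp, intensity_eq hp v', slope_injOn hp.pos h1.1 h1.2 h2.1 h2.2
      ((strictAntiOn_travelTime hp.pos hp.nonneg).injOn (h.lt_rate hp hx) (h'.lt_rate hp hx)
        (h3.trans h4.symm))]

/-- Surjectivity comes from the solution itself, since `F (η x) = x`. Injectivity holds because
travel time is strictly monotone in the slope and the slope determines `ξ`. -/
theorem eqInverseOnNonneg (h : IsCuspTail c κ v g) (hp : IsCuspParam c κ α) {F : ℝ → ℝ} {S : Set ℝ}
    (hS : ∀ ξ, (2 * κ - 1) * ξ ∈ S ↔ 0 < ξ ∧ 2 * κ * ξ ≤ 1)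
    (hF0 : ∀ ξ, 2 * κ * ξ = 1 → F ((2 * κ - 1) * ξ) = 0)
    (hF : ∀ ξ, 0 < ξ → 2 * κ * ξ < 1 → F ((2 * κ - 1) * ξ) = travelTime κ α (slope κ α ξ)) :
    EqInverseOnNonneg (intensity v) F S := by
  have hn := h.isNormalProfile hp
  have hrep : ∀ y ∈ S, ∃ ξ, y = (2 * κ - 1) * ξ ∧ 0 < ξ ∧ 2 * κ * ξ ≤ 1 := fun y hy => by
    have e : y = (2 * κ - 1) * (y / (2 * κ - 1)) := (mul_div_cancel₀ _ hp.ne).symm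
    exact ⟨_, e, (hS _).1 (e ▸ hy)⟩
  have hpos : ∀ ξ, 0 < ξ → 2 * κ * ξ < 1 → 0 < F ((2 * κ - 1) * ξ) := fun ξ h1 h2 => by
    rw [hF ξ h1 h2]
    exact travelTime_pos hp.pos hp.nonneg (Cuspon.lt_slope hp.pos hp.nonneg h1 (by linarith))
  have hmem : ∀ x, 0 ≤ x → intensity v x ∈ S ∧ F (intensity v x) = x := by
    intro x hx
    rw [intensity_eq hp, hS]
    rcases hx.eq_or_lt with rfl | hx
    · exact ⟨⟨hn.init_pos hp.pos, hn.init.le⟩, hF0 _ hn.init⟩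
    · have h1 := h.normalProfile_mem hp hx
      exact ⟨⟨h1.1, h1.2.le⟩, (hF _ h1.1 h1.2).trans (hn.travelTime_slope hp.pos hp.nonneg hx)⟩
  have hinj : InjOn F S := by
    intro y hy z hz hyz
    obtain ⟨ξ, rfl, h1, h2⟩ := hrep y hy
    obtain ⟨ζ, rfl, h1', h2'⟩ := hrep z hz
    congr 1
    rcases h2.eq_or_lt with e | e <;> rcases h2'.eq_or_lt with e' | e'
    · exact mul_left_cancel₀ (by linarith [hp.pos] : 2 * κ ≠ 0) (e.trans e'.symm)
    · rw [hF0 ξ e] at hyz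
      exact absurd hyz (hpos ζ h1' e').ne
    · rw [hF0 ζ e'] at hyz
      exact absurd hyz (hpos ξ h1 e).ne'
    · rw [hF ξ h1 e, hF ζ h1' e'] at hyz
      exact slope_injOn hp.pos h1 e h1' e' ((strictAntiOn_travelTime hp.pos hp.nonneg).injOn
        (Cuspon.lt_slope hp.pos hp.nonneg h1 (by linarith))
        (Cuspon.lt_slope hp.pos hp.nonneg h1' (by linarith)) hyz)
  refine ⟨⟨?_, hinj, fun x hx => ⟨_, hmem x hx⟩⟩, fun x hx => ?_⟩
  · intro y hy
    obtain ⟨ξ, rfl, h1, h2⟩ := hrep y hy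
    rcases h2.eq_or_lt with e | e
    · exact (hF0 ξ e).ge
    · exact (hpos ξ h1 e).le
  · have := hinj.leftInvOn_invFunOn (hmem x hx).1
    rw [(hmem x hx).2] at this
    exact this.symm

end IsCuspTail

end Cuspon

namespace Cuspon

/-! ### The explicit profile functions -/

section Profiles

variable {c κ α ξ : ℝ}

theorem profile_arg_ne (hκ : 0 < κ) (ht : 2 * κ - 1 ≠ 0) (h1 : 2 * κ * ξ < 1) :
    (2 * κ - 1) * ξ ≠ 1 - 1 / (2 * κ) := by
  rw [show 1 - 1 / (2 * κ) = (2 * κ - 1) * (1 / (2 * κ)) by field_simp]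
  intro h
  have := mul_left_cancel₀ ht h
  rw [this] at h1
  field_simp at h1
  linarith

/-- Numerators and denominators under the roots share the same power of `-(2κ-1)`, up to the factors
`α²`; these powers cancel whatever the sign, so one computation serves both regions. -/
theorem profileF_eq_travelTime (hp : IsCuspParam c κ α) (hα : 0 < α) (h0 : 0 < ξ)
    (h1 : 2 * κ * ξ < 1) : profileF c κ ((2 * κ - 1) * ξ) = travelTime κ α (slope κ α ξ) := by
  have ht := hp.ne
  have h1' : 0 < 1 - 2 * κ * ξ := by linarith
  have hnum : 0 < α ^ 2 + 2 * ξ := by positivity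
  have hr := hp.nonneg.trans_lt (lt_slope hp.pos hp.nonneg h0 h1')
  have hsq := slope_sq (α := α) h0.le h1'
  have e1 : 2 - c ^ 2 - 2 * ((2 * κ - 1) * ξ) = -(2 * κ - 1) * (α ^ 2 + 2 * ξ) := by
    linear_combination -hp.eqn
  have e2 : 1 - 2 * κ + 2 * κ * ((2 * κ - 1) * ξ) = -(2 * κ - 1) * (1 - 2 * κ * ξ) := by ring
  have e3 : 2 - c ^ 2 = -(2 * κ - 1) * α ^ 2 := by linear_combination -hp.eqn
  have e4 : 1 - 2 * κ = -(2 * κ - 1) := by ring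
  have ht' : -(2 * κ - 1) ≠ 0 := neg_ne_zero.2 ht
  have s1 : √((2 - c ^ 2 - 2 * ((2 * κ - 1) * ξ)) / (1 - 2 * κ + 2 * κ * ((2 * κ - 1) * ξ)))
      = slope κ α ξ := by
    rw [e1, e2, mul_div_mul_left _ _ ht', slope]
  have s2 : √((1 - 2 * κ) / (2 - c ^ 2)) = 1 / α := by
    rw [e3, e4, show -(2 * κ - 1) / (-(2 * κ - 1) * α ^ 2) = (1 / α) ^ 2 by field_simp]
    exact Real.sqrt_sq (by positivity)
  have s3 : √(((2 - c ^ 2) * (1 - 2 * κ + 2 * κ * ((2 * κ - 1) * ξ))) /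
      ((1 - 2 * κ) * (2 - c ^ 2 - 2 * ((2 * κ - 1) * ξ)))) = α / slope κ α ξ := by
    rw [e1, e2, e3, e4, show -(2 * κ - 1) * α ^ 2 * (-(2 * κ - 1) * (1 - 2 * κ * ξ)) /
      (-(2 * κ - 1) * (-(2 * κ - 1) * (α ^ 2 + 2 * ξ))) = (α / slope κ α ξ) ^ 2 by
        rw [div_pow, hsq]
        field_simp]
    exact Real.sqrt_sq (by positivity)
  rw [profileF, if_neg (profile_arg_ne hp.pos ht h1), s1, s2, s3, travelTime, if_neg hα.ne']
  ring

theorem profileG_eq_travelTime (hκ : 0 < κ) (ht : 2 * κ - 1 ≠ 0) (h0 : 0 < ξ)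
    (h1 : 2 * κ * ξ < 1) : profileG κ ((2 * κ - 1) * ξ) = travelTime κ 0 (slope κ 0 ξ) := by
  have h1' : 0 < 1 - 2 * κ * ξ := by linarith
  have hr := lt_slope hκ le_rfl h0 h1'
  have hsq := slope_sq (α := 0) h0.le h1'
  have e2 : 1 - 2 * κ + 2 * κ * ((2 * κ - 1) * ξ) = -(2 * κ - 1) * (1 - 2 * κ * ξ) := by ring
  have ht' : -(2 * κ - 1) ≠ 0 := neg_ne_zero.2 ht
  have s1 : √((-2 * κ * ((2 * κ - 1) * ξ)) / (1 - 2 * κ + 2 * κ * ((2 * κ - 1) * ξ)))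
      = √κ * slope κ 0 ξ := by
    rw [e2, show -2 * κ * ((2 * κ - 1) * ξ) = -(2 * κ - 1) * (κ * (0 ^ 2 + 2 * ξ)) by ring,
      mul_div_mul_left _ _ ht', mul_div_assoc, Real.sqrt_mul hκ.le, slope]
  have s2 : √2 * √(-((1 - 2 * κ + 2 * κ * ((2 * κ - 1) * ξ)) / ((2 * κ - 1) * ξ)))
      = 2 / slope κ 0 ξ := by
    rw [← Real.sqrt_mul zero_le_two, e2, show 2 * -(-(2 * κ - 1) * (1 - 2 * κ * ξ) /
      ((2 * κ - 1) * ξ)) = (2 / slope κ 0 ξ) ^ 2 by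
        rw [div_pow, hsq]
        field_simp
        ring]
    exact Real.sqrt_sq (by positivity)
  rw [profileG, if_neg (profile_arg_ne hκ ht h1), s1, s2, travelTime, if_pos rfl, mul_assoc]

theorem mem_intervalT_iff (hκ : 0 < κ) (ht : 2 * κ - 1 < 0) :
    (2 * κ - 1) * ξ ∈ intervalT κ ↔ 0 < ξ ∧ 2 * κ * ξ ≤ 1 := by
  have h : (2 * κ - 1) * ξ < 0 ↔ 0 < ξ :=
    ⟨fun h => not_le.1 fun h' => absurd (mul_nonneg_of_nonpos_of_nonpos ht.le h') (not_le.2 h),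
      mul_neg_of_neg_of_pos ht⟩
  rw [intervalT, mem_Ico, show 1 - 1 / (2 * κ) = (2 * κ - 1) * (1 / (2 * κ)) by field_simp,
    mul_le_mul_left_of_neg ht, le_div_iff₀ (by positivity), h, and_comm, mul_comm ξ]

theorem mem_intervalJ_iff (hκ : 0 < κ) (ht : 0 < 2 * κ - 1) :
    (2 * κ - 1) * ξ ∈ intervalJ κ ↔ 0 < ξ ∧ 2 * κ * ξ ≤ 1 := by
  rw [intervalJ, mem_Ioc, show 1 - 1 / (2 * κ) = (2 * κ - 1) * (1 / (2 * κ)) by field_simp,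
    mul_le_mul_iff_right₀ ht, le_div_iff₀ (by positivity), mul_pos_iff_of_pos_left ht, mul_comm ξ]

theorem profile_arg_eq (hκ : 0 < κ) (h1 : 2 * κ * ξ = 1) :
    (2 * κ - 1) * ξ = 1 - 1 / (2 * κ) := by
  rw [show ξ = 1 / (2 * κ) by field_simp; linarith]
  field_simp

end Profiles

namespace IsCuspTail

variable {c κ α : ℝ} {v g : ℝ → ℂ}

theorem eqInverse_profileF (h : IsCuspTail c κ v g) (hp : IsCuspParam c κ α) (hα : 0 < α)
    {S : Set ℝ} (hS : ∀ ξ, (2 * κ - 1) * ξ ∈ S ↔ 0 < ξ ∧ 2 * κ * ξ ≤ 1) :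
    EqInverseOnNonneg (intensity v) (profileF c κ) S :=
  h.eqInverseOnNonneg hp hS (fun _ e => if_pos (profile_arg_eq hp.pos e))
    fun _ h0 h1 => profileF_eq_travelTime hp hα h0 h1

theorem eqInverse_profileG (h : IsCuspTail c κ v g) (hp : IsCuspParam c κ 0)
    {S : Set ℝ} (hS : ∀ ξ, (2 * κ - 1) * ξ ∈ S ↔ 0 < ξ ∧ 2 * κ * ξ ≤ 1) :
    EqInverseOnNonneg (intensity v) (profileG κ) S :=
  h.eqInverseOnNonneg hp hS (fun _ e => if_pos (profile_arg_eq hp.pos e))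
    fun _ h0 h1 => profileG_eq_travelTime hp.pos hp.ne h0 h1

end IsCuspTail

/-! ### Reflection -/

/-- The reflection `x ↦ conj u(a - x)`, which preserves the equation. -/
noncomputable def reflect (a : ℝ) (v : ℝ → ℂ) (x : ℝ) : ℂ := starRingEnd ℂ (v (a - x))

theorem intensity_reflect (a : ℝ) (v : ℝ → ℂ) (x : ℝ) :
    intensity (reflect a v) x = intensity v (a - x) := by
  simp only [intensity, reflect, RCLike.norm_conj]

/-- Reversing `x` changes the sign of the angular momentum, and conjugation changes it back, so the
reflected curve satisfies the momentum relation with the same `c`. -/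
theorem isCuspTail_reflect {c κ a : ℝ} {v g : ℝ → ℂ} (hv : Continuous v)
    (ha : ‖v a‖ ^ 2 = 1 / (2 * κ)) (hne : ∀ x, x < a → ‖v x‖ ^ 2 ≠ 1 / (2 * κ))
    (hcurve : IsIntegralCurveOn c κ v g (Iio a)) :
    IsCuspTail c κ (reflect a v) (fun x => -reflect a g x) where
  continuousOn := (Complex.continuous_conj.comp (hv.comp (by fun_prop))).continuousOn
  init := by simpa [reflect] using ha
  ne x hx := by simpa [reflect] using hne (a - x) (by linarith)
  curve := by
    have hmem : ∀ x ∈ Ioi (0 : ℝ), a - x ∈ Iio a := fun x hx => by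
      rw [mem_Iio]
      linarith [mem_Ioi.1 hx]
    refine ⟨fun x hx => ?_, ?_, fun x hx => ?_, fun x hx => ?_⟩
    · have h1 := (hcurve.hasDerivAt _ (hmem x hx)).comp_const_sub a x
      have h2 := Complex.conjCLE.toContinuousLinearMap.hasFDerivAt.comp_hasDerivAt x h1
      convert! h2 using 1
    · have h1 : ContinuousOn (fun x => g (a - x)) (Ioi 0) :=
        hcurve.continuousOn.comp (Continuous.continuousOn (by fun_prop)) hmem
      exact (Complex.continuous_conj.comp_continuousOn h1).neg
    · rw [intensity_reflect, ← hcurve.momentum _ (hmem x hx)]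
      simp [reflect, cross]
    · have h1 := hcurve.energy _ (hmem x hx)
      rw [intensity_reflect, norm_neg]
      simp only [reflect, RCLike.norm_conj]
      rw [h1]
      simp only [dot, Complex.neg_re, Complex.neg_im, Complex.conj_re, Complex.conj_im]
      ring

/-! ### Parameter regions -/

/-- In all four regions `c² - 2` is zero or has the sign of `2κ - 1`, so `α² = (c²-2)/(2κ-1)` is
solvable; it vanishes exactly for `c = √2`. -/
theorem exists_isCuspParam {c κ : ℝ} (h : (c, κ) ∈ DTilde) :
    ∃ α, IsCuspParam c κ α ∧ ((c, κ) ∈ D1 ∪ D3 → 0 < α) ∧ ((c, κ) ∈ BPlus ∪ BMinus → α = 0) := by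
  have h2 : √(2 : ℝ) ^ 2 = 2 := Real.sq_sqrt zero_le_two
  have h3 : 0 < √(2 : ℝ) := Real.sqrt_pos.2 two_pos
  have key : 0 < κ → 2 * κ - 1 ≠ 0 → 0 ≤ (c ^ 2 - 2) / (2 * κ - 1) →
      IsCuspParam c κ √((c ^ 2 - 2) / (2 * κ - 1)) := fun h4 h5 h6 =>
    ⟨h4, Real.sqrt_nonneg _, h5, by rw [Real.sq_sqrt h6]; field_simp⟩
  refine ⟨√((c ^ 2 - 2) / (2 * κ - 1)), ?_, ?_, ?_⟩
  · rcases h with ((h | h) | h) | h <;> simp only [D1, D3, BMinus, BPlus, mem_ofPred_eq] at h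
    · obtain ⟨a1, a2, a3, a4⟩ := h
      exact key a3 (by linarith) (div_nonneg_of_nonpos (by nlinarith) (by linarith))
    · obtain ⟨a1, a2⟩ := h
      exact key (by linarith) (by linarith) (div_nonneg (by nlinarith) (by linarith))
    · obtain ⟨rfl, a3, a4⟩ := h
      exact key a3 (by linarith) (by rw [h2]; simp)
    · obtain ⟨rfl, a3⟩ := h
      exact key (by linarith) (by linarith) (by rw [h2]; simp)
  · rintro (h | h) <;> simp only [D1, D3, mem_ofPred_eq] at h
    · obtain ⟨a1, a2, a3, a4⟩ := h
      exact Real.sqrt_pos.2 (div_pos_of_neg_of_neg (by nlinarith) (by linarith))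
    · obtain ⟨a1, a2⟩ := h
      exact Real.sqrt_pos.2 (div_pos (by nlinarith) (by linarith))
  · rintro (h | h) <;> simp only [BPlus, BMinus, mem_ofPred_eq] at h <;> rw [h.1, h2] <;> simp

theorem two_mul_sub_one_neg {c κ : ℝ} (h : (c, κ) ∈ D1 ∪ BMinus) : 2 * κ - 1 < 0 := by
  rcases h with h | h <;> simp only [D1, BMinus, mem_ofPred_eq] at h
  · linarith [h.2.2.2]
  · linarith [h.2.2]

theorem two_mul_sub_one_pos {c κ : ℝ} (h : (c, κ) ∈ D3 ∪ BPlus) : 0 < 2 * κ - 1 := by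
  rcases h with h | h <;> simp only [D3, BPlus, mem_ofPred_eq] at h <;> linarith [h.2]

end Cuspon

/-! ### Assembly of the theorem -/

/-- A finite-energy weak solution `u` has a continuous representative `v` (unique, as two
continuous functions that agree almost everywhere are equal), and `v` has the stated cuspon
profile outside `[a, 0]`, `a = inf Γ(v)`, if it is singular (not `C²`) and `Γ(v)` is nonempty and
bounded with supremum `0`. -/
theorem theorem1p3 (c κ : ℝ) (hcκ : (c, κ) ∈ Cuspon.DTilde) (u : ℝ → ℂ)
    (hu : u ∈ Cuspon.EnergySpace) (hsol : Cuspon.IsWeakSolution c κ u) :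
    ∃ v : ℝ → ℂ, Continuous v ∧ v =ᵐ[volume] u ∧
      (¬ ContDiff ℝ 2 v →
        (Cuspon.criticalSet κ v).Nonempty →
        Bornology.IsBounded (Cuspon.criticalSet κ v) →
        sSup (Cuspon.criticalSet κ v) = 0 →
        ∀ (a : ℝ) (η : ℝ → ℝ), a = sInf (Cuspon.criticalSet κ v) → η = Cuspon.intensity v →
          -- explicit profile on the right
          ((c, κ) ∈ Cuspon.D1 →
            Cuspon.EqInverseOnNonneg η (Cuspon.profileF c κ) (Cuspon.intervalT κ)) ∧
          ((c, κ) ∈ Cuspon.D3 →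
            Cuspon.EqInverseOnNonneg η (Cuspon.profileH c κ) (Cuspon.intervalJ κ)) ∧
          ((c, κ) ∈ Cuspon.BMinus →
            Cuspon.EqInverseOnNonneg η (Cuspon.profileG κ) (Cuspon.intervalT κ)) ∧
          ((c, κ) ∈ Cuspon.BPlus →
            Cuspon.EqInverseOnNonneg η (Cuspon.profileGTilde κ) (Cuspon.intervalJ κ)) ∧
          -- reflection on the left
          (∀ x, x ≤ a → η x = η (a - x)) ∧
          -- range
          ((c, κ) ∈ Cuspon.D1 ∪ Cuspon.BMinus →
            ∀ x ∈ Iio a ∪ Ioi 0, 1 - 1 / (2 * κ) < η x ∧ η x < 0) ∧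
          ((c, κ) ∈ Cuspon.D3 ∪ Cuspon.BPlus →
            ∀ x ∈ Iio a ∪ Ioi 0, 0 < η x ∧ η x < 1 - 1 / (2 * κ)) ∧
          -- polar form and phase
          (∃ θ : ℝ → ℝ, ∀ x ∈ Iio a ∪ Ioi 0,
            v x = (√(1 - η x) : ℂ) * Complex.exp (Complex.I * (θ x : ℂ)) ∧
            HasDerivAt θ (c * η x / (2 - 2 * η x)) x) ∧
          -- regularity
          ContDiffOn ℝ ∞ v (Iio a ∪ Ioi 0) ∧
          -- one-sided limits of the derivative of the profile
          ((c, κ) ∈ Cuspon.D1 ∪ Cuspon.BMinus →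
            Tendsto (deriv η) (𝓝[<] a) atBot ∧ Tendsto (deriv η) (𝓝[>] 0) atTop) ∧
          ((c, κ) ∈ Cuspon.D3 ∪ Cuspon.BPlus →
            Tendsto (deriv η) (𝓝[<] a) atTop ∧ Tendsto (deriv η) (𝓝[>] 0) atBot) ∧
          -- decay
          ((c, κ) ∈ Cuspon.D1 ∪ Cuspon.D3 →
            ∀ j : ℕ, ∃ C₁ C₂ : ℝ, 0 < C₁ ∧ 0 < C₂ ∧ ∀ x, 1 ≤ x →
              ‖iteratedDeriv j (deriv v) x‖ + |iteratedDeriv j η x|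
                ≤ C₁ * Real.exp (-C₂ * x)) ∧
          ((c, κ) ∈ Cuspon.BPlus ∪ Cuspon.BMinus →
            ∀ j : ℕ, ∃ C₃ : ℝ, 0 < C₃ ∧ ∀ x, 1 ≤ x →
              ‖iteratedDeriv j (deriv v) x‖ + |iteratedDeriv j η x|
                ≤ C₃ * x ^ (-(2 + (j : ℤ))))) := by
  obtain ⟨α, hp, hαpos, hαzero⟩ := Cuspon.exists_isCuspParam hcκ
  obtain ⟨v, hv, hvu, hcurve⟩ := Cuspon.exists_integralCurve hp.pos hu hsol
  refine ⟨v, hv, hvu, ?_⟩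
  rintro - hne hbdd hsup a η ha rfl
  have hclosed : IsClosed (Cuspon.criticalSet κ v) :=
    isClosed_eq (by fun_prop) continuous_const
  have h0mem : (0 : ℝ) ∈ Cuspon.criticalSet κ v :=
    hsup ▸ hclosed.csSup_mem hne hbdd.bddAbove
  have hamem : a ∈ Cuspon.criticalSet κ v :=
    ha ▸ hclosed.csInf_mem hne hbdd.bddBelow
  have hright : ∀ x, 0 < x → x ∉ Cuspon.criticalSet κ v := fun x hx hmem =>
    absurd (hsup ▸ le_csSup hbdd.bddAbove hmem) (not_le.2 hx)
  have hleft : ∀ x, x < a → x ∉ Cuspon.criticalSet κ v := fun x hx hmem =>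
    absurd (ha ▸ csInf_le hbdd.bddBelow hmem) (not_le.2 hx)
  have ha0 : a ≤ 0 := not_lt.1 fun h => hright a h hamem
  obtain ⟨g, hg⟩ := hcurve (Ioi 0) isOpen_Ioi isPreconnected_Ioi Real.volume_Ioi
    (Set.disjoint_left.2 hright)
  obtain ⟨g', hg'⟩ := hcurve (Iio a) isOpen_Iio isPreconnected_Iio Real.volume_Iio
    (Set.disjoint_left.2 hleft)
  have T : Cuspon.IsCuspTail c κ v g := ⟨hv.continuousOn, h0mem, hright, hg⟩
  have T' := Cuspon.isCuspTail_reflect hv hamem hleft hg'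
  -- The right tail and the reflected left tail solve the same normalised problem, hence have the
  -- same profile.
  have hrefl : ∀ x, x ≤ a → Cuspon.intensity v x = Cuspon.intensity v (a - x) := by
    intro x hx
    rw [T.intensity_unique T' hp (sub_nonneg.2 hx), Cuspon.intensity_reflect, sub_sub_cancel]
  have hderiv : ∀ᶠ x in 𝓝[<] a,
      deriv (Cuspon.intensity v) x = -deriv (Cuspon.intensity v) (a - x) := by
    filter_upwards [self_mem_nhdsWithin] with x hx
    rw [← deriv_comp_const_sub]
    apply Filter.EventuallyEq.deriv_eq
    filter_upwards [Iio_mem_nhds hx] with y hy using hrefl y hy.le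
  have hsub : Tendsto (fun x => a - x) (𝓝[<] a) (𝓝[>] 0) := by
    refine tendsto_nhdsWithin_iff.2 ⟨?_, ?_⟩
    · have : ContinuousAt (fun x => a - x) a := by fun_prop
      simpa using this.tendsto.mono_left nhdsWithin_le_nhds
    · filter_upwards [self_mem_nhdsWithin] with x hx
      exact sub_pos.2 (mem_Iio.1 hx)
  refine ⟨fun h => ?_, fun h => ?_, fun h => ?_, fun h => ?_, hrefl, fun h => ?_, fun h => ?_, ?_,
    ?_, fun h => ?_, fun h => ?_, fun h j => ?_, fun h j => ?_⟩
  · exact T.eqInverse_profileF hp (hαpos (Or.inl h)) fun _ =>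
      Cuspon.mem_intervalT_iff hp.pos (Cuspon.two_mul_sub_one_neg (Or.inl h))
  · exact T.eqInverse_profileF hp (hαpos (Or.inr h)) fun _ =>
      Cuspon.mem_intervalJ_iff hp.pos (Cuspon.two_mul_sub_one_pos (Or.inl h))
  · obtain rfl := hαzero (Or.inr h)
    exact T.eqInverse_profileG hp fun _ =>
      Cuspon.mem_intervalT_iff hp.pos (Cuspon.two_mul_sub_one_neg (Or.inr h))
  · obtain rfl := hαzero (Or.inl h)
    exact T.eqInverse_profileG hp fun _ =>
      Cuspon.mem_intervalJ_iff hp.pos (Cuspon.two_mul_sub_one_pos (Or.inr h))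
  · rintro x (hx | hx)
    · rw [hrefl x (mem_Iio.1 hx).le]
      exact T.range_of_lt hp (Cuspon.two_mul_sub_one_neg h) (sub_pos.2 hx)
    · exact T.range_of_lt hp (Cuspon.two_mul_sub_one_neg h) hx
  · rintro x (hx | hx)
    · rw [hrefl x (mem_Iio.1 hx).le]
      exact T.range_of_gt hp (Cuspon.two_mul_sub_one_pos h) (sub_pos.2 hx)
    · exact T.range_of_gt hp (Cuspon.two_mul_sub_one_pos h) hx
  · obtain ⟨θ, hθ⟩ := T.exists_phase hp
    obtain ⟨θ', hθ'⟩ := T'.exists_phase hp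
    -- Undoing the conjugation negates the phase; this sign and the one from `x ↦ a - x` cancel in
    -- the derivative.
    refine ⟨fun x => if x < a then -θ' (a - x) else θ x, ?_⟩
    rintro x (hx | hx)
    · obtain ⟨h1, h2⟩ := hθ' (a - x) (sub_pos.2 hx)
      rw [Cuspon.intensity_reflect, sub_sub_cancel] at h1 h2
      refine ⟨?_, ?_⟩
      · simp only [if_pos (mem_Iio.1 hx)]
        have h3 := congrArg (starRingEnd ℂ) h1
        rw [Cuspon.reflect, sub_sub_cancel, Complex.conj_conj, map_mul, ← Complex.exp_conj, map_mul,
          Complex.conj_I, Complex.conj_ofReal, Complex.conj_ofReal] at h3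
        rw [h3]
        simp
      · have h3 := (h2.comp_const_sub a x).neg
        rw [neg_neg] at h3
        refine h3.congr_of_eventuallyEq ?_
        filter_upwards [Iio_mem_nhds (mem_Iio.1 hx)] with y hy
        exact if_pos hy
    · obtain ⟨h1, h2⟩ := hθ x hx
      have hx' : a < x := ha0.trans_lt hx
      refine ⟨?_, ?_⟩
      · simp only [if_neg hx'.not_gt]
        exact h1
      · refine h2.congr_of_eventuallyEq ?_
        filter_upwards [Ioi_mem_nhds hx'] with y hy
        exact if_neg (mem_Ioi.1 hy).not_gt
  · refine ContDiffOn.union_of_isOpen ?_ (T.contDiffOn hp) isOpen_Iio isOpen_Ioi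
    have h1 : ContDiffOn ℝ ∞ (fun x => Cuspon.reflect a v (a - x)) (Iio a) :=
      (T'.contDiffOn hp).comp (ContDiff.contDiffOn (by fun_prop)) fun x hx => mem_Ioi.2 (sub_pos.2 hx)
    have h2 := Complex.conjCLE.contDiff.comp_contDiffOn (n := ∞) h1
    refine h2.congr fun x hx => ?_
    simp [Cuspon.reflect]
  · have h1 := T.tendsto_deriv_of_lt hp (Cuspon.two_mul_sub_one_neg h)
    exact ⟨(tendsto_neg_atTop_atBot.comp (h1.comp hsub)).congr' (hderiv.mono fun x hx => hx.symm), h1⟩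
  · have h1 := T.tendsto_deriv_of_gt hp (Cuspon.two_mul_sub_one_pos h)
    exact ⟨(tendsto_neg_atBot_atTop.comp (h1.comp hsub)).congr' (hderiv.mono fun x hx => hx.symm), h1⟩
  · exact T.exponential_decay hp (hαpos h) j
  · obtain rfl := hαzero h
    exact T.algebraic_decay hp j
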